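/- For $r\ge 0$ let $\zeta_r(s_1,\dots,s_r)$ denote the Euler–Zagier multiple zeta function, i.e. the meromorphic continuation to $\mathbb C^r$ of $$\sum_{0<n_1<n_2<\cdots<n_r}\frac1{n_1^{s_1}n_2^{s_2}\cdots n_r^{s_r}},$$ which converges absolutely for $\operatorname{Re}(s_{r-k+1}+\cdots+s_r)>k$ $(1\le k\le r)$. This continuation exists and is holomorphic outside the set $\Sigma_r$ of all $(s_1,\dots,s_r)$ with $s_r=1$, or $s_{r-1}+s_r\in\{2,1,0,-2,-4,-6,\dots\}$ (if $r\ge2$), or $s_{r-k+1}+\cdots+s_r\in\mathbb Z_{\le k}$ for some $3\le k\le r$. Write $\zeta$ for the Riemann zeta function and $\delta$ for Kronecker's delta. **Theorem.** Let $r\ge 2$, $j\in\{1,\dots,r\}$ and $n_j\in\mathbb N_0=\{0,1,2,\dots\}$. Then, as meromorphic functions of the complex variables $s_1,\dots,s_{j-1},s_{j+1},\dots,s_r$, $$\begin{aligned} &\zeta_r(s_1,\dots,s_{j-1},-n_j,s_{j+1},\dots,s_r)\\ &= -(1-\delta_{j1})\frac1{n_j+1}\,\zeta_{r-1}(s_1,\dots,s_{j-2},s_{j-1}-n_j-1,s_{j+1},\dots,s_r)\\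 &\quad+(1-\delta_{jr})\frac1{n_j+1}\,\zeta_{r-1}(s_1,\dots,s_{j-1},s_{j+1}-n_j-1,s_{j+2},\dots,s_r)\\ &\quad+(1-\delta_{j1})\sum_{k=0}^{n_j}\binom{n_j}{k}\,\zeta_{r-1}(s_1,\dots,s_{j-2},s_{j-1}-n_j+k,s_{j+1},\dots,s_r)\,\zeta(-k)\\ &\quad-(1-\delta_{jr})\sum_{k=0}^{n_j}\binom{n_j}{k}\,\zeta_{r-1}(s_1,\dots,s_{j-1},s_{j+1}-n_j+k,s_{j+2},\dots,s_r)\,\zeta(-k)\\ &\quad+\delta_{j1}(1-\delta_{jr})\,\zeta(-n_1)\,\zeta_{r-1}(s_2,\dots,s_r)\\ &\quad+(\delta_{jr}-1)\,\zeta_{r-1}(s_1,\dots,s_{j-1},s_{j+1}-n_j,s_{j+2},\dots,s_r). \end{aligned}$$ Terms whose Kronecker coefficient is $0$ are absent. More precisely, the identity holds at every point with $(s_1,\dots,s_{j-1},-n_j,s_{j+1},\dots,s_r)\notin\Sigma_r$; there, all terms on the right with nonzero coefficient are regular (terms with $\zeta(-k)=0$, i.e. $k\ge2$ even, being read as $0$).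 -/

import Mathlib

open Filter Topology

/-- The index set `{0 < n₁ < n₂ < ⋯ < n_r}` of the Euler–Zagier series. -/
abbrev MZIndex (r : ℕ) : Type :=
  {n : Fin r → ℕ // StrictMono n ∧ ∀ i, 0 < n i}

/-- The summand `1 / (n₁ ^ s₁ ⋯ n_r ^ s_r)`. -/
noncomputable def mzTerm (r : ℕ) (s : Fin r → ℂ) (n : MZIndex r) : ℂ :=
  ∏ i, 1 / ((n.1 i : ℂ) ^ s i)

/-- The sum of the last `k` variables, `s_{r-k+1} + ⋯ + s_r` (for `k ≤ r`; the entry `i : Fin r`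
is the variable `s_{i+1}`). -/
noncomputable def tailSum (r : ℕ) (s : Fin r → ℂ) (k : ℕ) : ℂ :=
  ∑ i : Fin r, if r ≤ (i : ℕ) + k then s i else 0

/-- The region of absolute convergence `Re (s_{r-k+1} + ⋯ + s_r) > k`, `1 ≤ k ≤ r`. -/
def convRegion (r : ℕ) : Set (Fin r → ℂ) :=
  {s | ∀ k : ℕ, 1 ≤ k → k ≤ r → (k : ℝ) < (tailSum r s k).re}

/-- The integers `a` such that `s_{r-k+1} + ⋯ + s_r = a` is a singular hyperplane:
`a = 1` for `k = 1`; `a = 2, 1, 0, -2, -4, …` for `k = 2`; all `a ≤ k` for `k ≥ 3`. -/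
def IsPolarValue (k : ℕ) (a : ℤ) : Prop :=
  (k = 1 ∧ a = 1) ∨ (k = 2 ∧ (a = 1 ∨ (Even a ∧ a ≤ 2))) ∨ (3 ≤ k ∧ a ≤ k)

/-- The singular set of the `r`-fold zeta function, a locally finite union of hyperplanes. -/
def singularSet (r : ℕ) : Set (Fin r → ℂ) :=
  {s | ∃ k : ℕ, 1 ≤ k ∧ k ≤ r ∧ ∃ a : ℤ, IsPolarValue k a ∧ tailSum r s k = a}

/-- Meromorphic functions of several variables: near every point, `f` is a quotient `p / q` of
holomorphic functions with `q` not identically zero near that point. -/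
def IsMeromorphicSV (r : ℕ) (f : (Fin r → ℂ) → ℂ) : Prop :=
  ∀ z : Fin r → ℂ, ∃ p q : (Fin r → ℂ) → ℂ,
    AnalyticAt ℂ p z ∧ AnalyticAt ℂ q z ∧ (∃ᶠ w in 𝓝 z, q w ≠ 0) ∧
      ∀ᶠ w in 𝓝 z, q w ≠ 0 → f w = p w / q w

/-- `f` is the meromorphic continuation to `ℂ ^ r` of the Euler–Zagier series, holomorphic off the
singular set. The values of `f` on the singular set carry no information; off it, `f` is
determined, because the complement of the singular set is connected. -/
structure IsMultipleZeta (r : ℕ) (f : (Fin r → ℂ) → ℂ) : Prop where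
  hasSum : ∀ s ∈ convRegion r, HasSum (mzTerm r s) (f s)
  analytic : AnalyticOnNhd ℂ f (singularSet r)ᶜ
  meromorphic : IsMeromorphicSV r f

/-- The Euler–Zagier multiple zeta function `ζ_r(s₁, …, s_r)`. -/
noncomputable def multipleZeta (r : ℕ) : (Fin r → ℂ) → ℂ :=
  Classical.epsilon (IsMultipleZeta r)

/-- Kronecker's delta. -/
def kdelta {α : Type*} [DecidableEq α] (a b : α) : ℂ := if a = b then 1 else 0

/-- In the tuple `t = (s₁, …, s_{j-1}, s_{j+1}, …, s_r)`, `r = m + 1`, add `c` to the entry just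
before the omitted position (no change if there is none). -/
noncomputable def shiftBefore {m : ℕ} (j : Fin (m + 1)) (c : ℂ) (t : Fin m → ℂ) : Fin m → ℂ :=
  fun l => if (l : ℕ) + 1 = (j : ℕ) then t l + c else t l

/-- In the tuple `t = (s₁, …, s_{j-1}, s_{j+1}, …, s_r)`, `r = m + 1`, add `c` to the entry just
after the omitted position (no change if there is none). -/
noncomputable def shiftAfter {m : ℕ} (j : Fin (m + 1)) (c : ℂ) (t : Fin m → ℂ) : Fin m → ℂ :=
  fun l => if (l : ℕ) = (j : ℕ) then t l + c else t l

/-! Everything rests on the Euler–Maclaurin expansion of the innermost sum, over n_r > n_{r-1} = a: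
it equals a^{1-s}/(s-1), plus the terms (s)_k B_{k+1}/(k+1)! · a^{-s-k} for k < N, plus a remainder
of size O(a^{1-Re s-N}). Summing over the other indices expresses ζ_r through ζ_{r-1} at tuples
whose last two variables are merged, plus a series that converges on regions exhausting ℂ^r as N
grows (`mzStep`, `mzStep_succ`). By induction on the depth this gives the continuation
(`exists_isMultipleZeta`), so the `epsilon` in `multipleZeta` picks a genuine one. The shape of the
singular set comes from B_{k+1} = 0 for even k ≥ 2: only shifts by -1, 0 and positive odd integers
survive (`IsPolarValue.succ_sub`). Holomorphy of the remainder series follows from Osgood's lemma.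

If j < r, the formula is first proved where all the series involved converge. There n_j runs over a
finite interval between its neighbours, and Faulhaber's formula with Bernoulli numbers written as
ζ(-k) sums n_j^n (`sum_Ioo_zero_pow`, `sum_Ioo_pow`). Both sides are analytic off the singular set,
and a complex line through a regular point meets that set in countably many points, whose complement
in the line is connected; so the identity spreads (`multipleZeta_insertNth`).

If j = r, no region of convergence is available, but the expansion itself is exact at s_r = -n: the
factor (-n)_N kills the remainder for N > n (`emRem_neg_natCast`), and the coefficients become
binom(n,k) ζ(-k) (`emCoeff_neg_natCast`). The formula is then a direct evaluation
(`multipleZeta_insertNth_last`). -/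

/-! ### Osgood's lemma and locally dominated series of analytic functions. -/

section Osgood

open Complex Metric MeasureTheory
open scoped Real

/-- `f` is holomorphic in the variable `i` at the point `z`, the others being fixed. -/
def SepDifferentiableAt {m : ℕ} (f : (Fin m → ℂ) → ℂ) (z : Fin m → ℂ) : Prop :=
  ∀ i, DifferentiableAt ℂ (fun w => f (Function.update z i w)) (z i)

lemma torusMap_mem_closedBall {m : ℕ} (c : Fin m → ℂ) {R : ℝ} (hR : 0 ≤ R) (θ : Fin m → ℝ) :
    torusMap c (fun _ => R) θ ∈ closedBall c R := by
  rw [mem_closedBall, dist_pi_le_iff hR]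
  intro i
  simp [torusMap, Complex.norm_exp_ofReal_mul_I, abs_of_nonneg hR]

lemma continuous_torusMap {m : ℕ} (c : Fin m → ℂ) (R : Fin m → ℝ) : Continuous (torusMap c R) := by
  unfold torusMap; fun_prop

lemma continuous_torusMap_apply {m : ℕ} (c : Fin m → ℂ) (R : Fin m → ℝ) (i : Fin m) :
    Continuous fun θ => torusMap c R θ i := by
  unfold torusMap; fun_prop

lemma torusMap_sub_ne_zero {m : ℕ} {c z : Fin m → ℂ} {R : ℝ} (hR : 0 < R) (hz : z ∈ ball c R)
    (θ : Fin m → ℝ) (i : Fin m) : torusMap c (fun _ => R) θ i - z i ≠ 0 := by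
  intro h
  rw [mem_ball, dist_pi_lt_iff hR] at hz
  have h1 := hz i
  rw [← sub_eq_zero.1 h, dist_eq] at h1
  simp [torusMap, Complex.norm_exp_ofReal_mul_I, abs_of_pos hR] at h1

/-- The Cauchy integral formula on a polydisc. -/
theorem torusIntegral_prod_sub_inv_mul {m : ℕ} (c : Fin m → ℂ) {R : ℝ} (hR : 0 < R)
    {f : (Fin m → ℂ) → ℂ} (hc : ContinuousOn f (closedBall c R))
    (hd : ∀ z ∈ closedBall c R, SepDifferentiableAt f z) {z : Fin m → ℂ} (hz : z ∈ ball c R) :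
    torusIntegral (fun ζ => (∏ i, (ζ i - z i)⁻¹) * f ζ) c (fun _ => R) =
      (2 * π * I : ℂ) ^ m * f z := by
  induction m with
  | zero =>
    rw [torusIntegral_dim0]
    simp [Subsingleton.elim c z]
  | succ m ih =>
    have hball : ∀ x y : Fin (m + 1) → ℂ, x ∈ closedBall y R ↔ ∀ i, dist (x i) (y i) ≤ R :=
      fun x y => by rw [mem_closedBall, dist_pi_le_iff hR.le]
    have hball' : ∀ x y : Fin m → ℂ, x ∈ closedBall y R ↔ ∀ i, dist (x i) (y i) ≤ R :=
      fun x y => by rw [mem_closedBall, dist_pi_le_iff hR.le]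
    have hz' : ∀ i, dist (z i) (c i) < R := by rwa [mem_ball, dist_pi_lt_iff hR] at hz
    have hcons : ∀ x ∈ closedBall (c 0) R, ∀ y ∈ closedBall (fun i => c (Fin.succ i)) R,
        (Fin.cons x y : Fin (m + 1) → ℂ) ∈ closedBall c R := by
      intro x hx y hy
      rw [hball]
      rw [hball'] at hy
      exact Fin.cases (by simpa using hx) (fun i => by simpa using hy i)
    have hint : TorusIntegrable (fun ζ => (∏ i, (ζ i - z i)⁻¹) * f ζ) c (fun _ => R) := by
      apply Continuous.integrableOn_Icc
      refine Continuous.mul ?_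
        (hc.comp_continuous (continuous_torusMap _ _) (torusMap_mem_closedBall c hR.le))
      refine continuous_finsetProd _ fun i _ => Continuous.inv₀ ?_
        (fun θ => torusMap_sub_ne_zero hR hz θ i)
      exact (continuous_torusMap_apply c _ i).sub continuous_const
    rw [torusIntegral_succ hint]
    -- The induction hypothesis integrates out every coordinate but the first; the one-variable
    -- Cauchy formula then handles the first.
    have hinner : ∀ x ∈ sphere (c 0) R,
        torusIntegral (fun y => (∏ i, ((Fin.cons x y : Fin (m + 1) → ℂ) i - z i)⁻¹) *
          f (Fin.cons x y)) (c ∘ Fin.succ) ((fun _ => R) ∘ Fin.succ) =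
        (x - z 0)⁻¹ • ((2 * π * I : ℂ) ^ m * f (Fin.cons x (fun i => z (Fin.succ i)))) := by
      intro x hx
      have hx := sphere_subset_closedBall hx
      have := @ih (fun i => c (Fin.succ i)) (fun y => f (Fin.cons x y)) ?_ ?_
        (fun i => z (Fin.succ i)) ?_
      · rw [← this, smul_eq_mul, ← torusIntegral_const_mul]
        simp only [Fin.prod_univ_succ, Fin.cons_zero, Fin.cons_succ, mul_assoc]
        rfl
      · refine hc.comp (Continuous.continuousOn ?_) (fun y hy => hcons x hx y hy)
        exact Continuous.finCons continuous_const continuous_id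
      · intro y hy i
        have := hd _ (hcons x hx y hy) (Fin.succ i)
        simpa only [← Fin.cons_update, Fin.cons_succ] using this
      · rw [mem_ball, dist_pi_lt_iff hR]
        exact fun i => hz' _
    rw [circleIntegral.integral_congr hR.le hinner]
    rw [circleIntegral_sub_inv_smul_of_differentiable_on_off_countable Set.countable_empty
      (by simpa using hz' 0)]
    · have : (Fin.cons (z 0) fun i => z (Fin.succ i) : Fin (m + 1) → ℂ) = z := Fin.cons_self_tail z
      rw [this, smul_eq_mul, pow_succ]
      ring
    · refine ContinuousOn.mul continuousOn_const (hc.comp (Continuous.continuousOn ?_) ?_)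
      · exact Continuous.finCons continuous_id continuous_const
      · exact fun x hx => hcons x hx _ (by rw [hball']; exact fun i => (hz' _).le)
    · intro x hx
      have := hd _ (hcons x (ball_subset_closedBall hx.1) (fun i => z (Fin.succ i))
        (by rw [hball']; exact fun i => (hz' _).le)) 0
      simp only [Fin.update_cons_zero, Fin.cons_zero] at this
      exact this.const_mul _

/-- The bounded function `θ ↦ c i + R e ^ {i θ i}` on `ℝ ^ m`. -/
noncomputable def torusCoord {m : ℕ} (c : Fin m → ℂ) (R : ℝ) (i : Fin m) :
    BoundedContinuousFunction (Fin m → ℝ) ℂ :=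
  BoundedContinuousFunction.ofNormedAddCommGroup (fun θ => torusMap c (fun _ => R) θ i)
    (continuous_torusMap_apply c _ i) (‖c i‖ + |R|) (fun θ => by
      refine (norm_add_le _ _).trans ?_
      simp [Complex.norm_exp_ofReal_mul_I])

/-- Integration over the torus as a continuous linear functional. -/
noncomputable def torusFunctional (m : ℕ) (R : ℝ) :
    BoundedContinuousFunction (Fin m → ℝ) ℂ →L[ℂ] ℂ :=
  LinearMap.mkContinuous
    { toFun := fun H => ∫ θ in Set.Icc (0 : Fin m → ℝ) fun _ => 2 * π,
        (∏ i, (R : ℂ) * exp (θ i * I) * I) • H θ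
      map_add' := fun H K => by
        simp only [BoundedContinuousFunction.coe_add, Pi.add_apply, smul_add]
        refine integral_add ?_ ?_
        · exact Continuous.integrableOn_Icc (by fun_prop)
        · exact Continuous.integrableOn_Icc (by fun_prop)
      map_smul' := fun a H => by
        simp only [BoundedContinuousFunction.coe_smul, smul_comm _ a, RingHom.id_apply]
        exact integral_smul _ _ }
    ((∏ _i : Fin m, |R|) * (volume (Set.Icc (0 : Fin m → ℝ) fun _ => 2 * π)).toReal) (fun H => by
      refine (norm_setIntegral_le_of_norm_le_const (C := (∏ _i : Fin m, |R|) * ‖H‖)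
        measure_Icc_lt_top fun θ _ => ?_).trans (le_of_eq ?_)
      · rw [norm_smul, norm_prod]
        simp only [norm_mul, Complex.norm_exp_ofReal_mul_I, norm_I, mul_one, Complex.norm_real,
          Real.norm_eq_abs]
        gcongr
        exact H.norm_coe_le_norm θ
      · rw [Measure.real]; ring)

/-- **Osgood's lemma**: a continuous function that is holomorphic in each variable separately is
analytic. -/
theorem analyticOnNhd_of_sepDifferentiableAt {m : ℕ} {U : Set (Fin m → ℂ)} (hU : IsOpen U)
    {f : (Fin m → ℂ) → ℂ} (hc : ContinuousOn f U) (hd : ∀ z ∈ U, SepDifferentiableAt f z) :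
    AnalyticOnNhd ℂ f U := by
  intro c hcU
  obtain ⟨R, hR, hball⟩ := nhds_basis_closedBall.mem_iff.1 (hU.mem_nhds hcU)
  have hcb := hc.mono hball
  have hdb : ∀ z ∈ closedBall c R, SepDifferentiableAt f z := fun z hz => hd z (hball hz)
  obtain ⟨M, hM⟩ := (isCompact_closedBall c R).exists_bound_of_continuousOn hcb
  let H : BoundedContinuousFunction (Fin m → ℝ) ℂ :=
    BoundedContinuousFunction.ofNormedAddCommGroup (fun θ => f (torusMap c (fun _ => R) θ))
      (hcb.comp_continuous (continuous_torusMap _ _) (torusMap_mem_closedBall c hR.le)) M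
      (fun θ => hM _ (torusMap_mem_closedBall c hR.le θ))
  -- On the torus |ζ_i - w| ≥ R - |w - c_i| > 0, so ζ_i - w is a unit of the Banach algebra of
  -- bounded continuous functions.
  have hκ : ∀ i : Fin m, ∀ w ∈ ball (c i) R, ∃ u : (BoundedContinuousFunction (Fin m → ℝ) ℂ)ˣ,
      (u : BoundedContinuousFunction (Fin m → ℝ) ℂ) =
        torusCoord c R i - algebraMap ℂ (BoundedContinuousFunction (Fin m → ℝ) ℂ) w ∧
      ∀ θ, (↑u⁻¹ : BoundedContinuousFunction (Fin m → ℝ) ℂ) θ =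
        (torusMap c (fun _ => R) θ i - w)⁻¹ := by
    intro i w hw
    rw [mem_ball, dist_eq] at hw
    have hlow : ∀ θ, R - ‖w - c i‖ ≤ ‖torusMap c (fun _ => R) θ i - w‖ := by
      intro θ
      have h1 : ‖torusMap c (fun _ => R) θ i - c i‖ = R := by
        simp [torusMap, Complex.norm_exp_ofReal_mul_I, abs_of_pos hR]
      have h2 := norm_sub_le (torusMap c (fun _ => R) θ i - w) (c i - w)
      rw [sub_sub_sub_cancel_right, h1, norm_sub_rev (c i) w] at h2
      linarith
    have hne : ∀ θ, torusMap c (fun _ => R) θ i - w ≠ 0 := fun θ => by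
      rw [← norm_pos_iff]; linarith [hlow θ]
    refine ⟨⟨_, BoundedContinuousFunction.ofNormedAddCommGroup
      (fun θ => (torusMap c (fun _ => R) θ i - w)⁻¹)
      (Continuous.inv₀ ((continuous_torusMap_apply c _ i).sub continuous_const) hne)
      (R - ‖w - c i‖)⁻¹ ?_, ?_, ?_⟩, rfl, fun θ => rfl⟩
    · intro θ
      rw [norm_inv]
      exact inv_anti₀ (by linarith) (hlow θ)
    · ext θ
      exact mul_inv_cancel₀ (hne θ)
    · ext θ
      exact inv_mul_cancel₀ (hne θ)
  -- Cauchy's formula writes f as a continuous linear functional of products of inverses in that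
  -- algebra. Inversion is analytic at units, so no power series has to be expanded by hand.
  have hformula : ∀ z ∈ ball c R, f z = ((2 * π * I : ℂ) ^ m)⁻¹ *
      torusFunctional m R ((∏ i, Ring.inverse (torusCoord c R i -
        algebraMap ℂ (BoundedContinuousFunction (Fin m → ℝ) ℂ) (z i))) * H) := by
    intro z hz
    have hpi : (2 * π * I : ℂ) ^ m ≠ 0 := pow_ne_zero _ (by simp [Real.pi_ne_zero])
    rw [eq_inv_mul_iff_mul_eq₀ hpi, ← torusIntegral_prod_sub_inv_mul c hR hcb hdb hz]
    have hz' : ∀ i, z i ∈ ball (c i) R := by rwa [mem_ball, dist_pi_lt_iff hR] at hz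
    choose u hu1 hu2 using fun i => hκ i (z i) (hz' i)
    simp only [← hu1, Ring.inverse_unit]
    refine integral_congr_ae (Eventually.of_forall fun θ => ?_)
    have : ∀ s : Finset (Fin m), (∏ i ∈ s, (↑(u i)⁻¹ : BoundedContinuousFunction _ ℂ)) θ =
        ∏ i ∈ s, (torusMap c (fun _ => R) θ i - z i)⁻¹ := by
      intro s
      induction s using Finset.induction_on with
      | empty => simp
      | insert a s ha ih => rw [Finset.prod_insert ha, Finset.prod_insert ha, ← ih, ← hu2]; rfl
    simp only [BoundedContinuousFunction.coe_mul, Pi.mul_apply, this]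
    rfl
  have hcongr : (fun z => ((2 * π * I : ℂ) ^ m)⁻¹ *
      torusFunctional m R ((∏ i, Ring.inverse (torusCoord c R i -
        algebraMap ℂ (BoundedContinuousFunction (Fin m → ℝ) ℂ) (z i))) * H)) =ᶠ[𝓝 c] f := by
    filter_upwards [ball_mem_nhds c hR] with z hz using (hformula z hz).symm
  refine AnalyticAt.congr ?_ hcongr
  refine analyticAt_const.mul (((torusFunctional m R).analyticAt _).comp ?_)
  refine AnalyticAt.mul (Finset.analyticAt_fun_prod _ fun i _ => ?_) analyticAt_const
  obtain ⟨u, hu, -⟩ := hκ i (c i) (mem_ball_self hR)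
  refine AnalyticAt.fun_comp (g := Ring.inverse) ?_ ?_
  · rw [← hu]; exact analyticAt_inverse u
  · refine analyticAt_const.sub ?_
    exact ((Algebra.linearMap ℂ (BoundedContinuousFunction (Fin m → ℝ) ℂ)).mkContinuous 1
      (fun x => by simp)).analyticAt _ |>.comp
      ((ContinuousLinearMap.proj (R := ℂ) (φ := fun _ : Fin m => ℂ) i).analyticAt _)

/-- A locally dominated series of analytic functions is analytic. -/
theorem analyticOnNhd_tsum {ι : Type*} {m : ℕ} {U : Set (Fin m → ℂ)} (hU : IsOpen U)
    {g : ι → (Fin m → ℂ) → ℂ} (hg : ∀ i, AnalyticOnNhd ℂ (g i) U)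
    (hdom : ∀ z ∈ U, ∃ V ∈ 𝓝 z, ∃ u : ι → ℝ, Summable u ∧ ∀ i, ∀ w ∈ V, ‖g i w‖ ≤ u i) :
    AnalyticOnNhd ℂ (fun z => ∑' i, g i z) U := by
  have hdom' : ∀ z ∈ U, ∃ V, IsOpen V ∧ z ∈ V ∧ V ⊆ U ∧ ∃ u : ι → ℝ, Summable u ∧
      ∀ i, ∀ w ∈ V, ‖g i w‖ ≤ u i := by
    intro z hz
    obtain ⟨V, hV, u, hu, hb⟩ := hdom z hz
    refine ⟨interior V ∩ U, isOpen_interior.inter hU, ⟨mem_interior_iff_mem_nhds.2 hV, hz⟩,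
      Set.inter_subset_right, u, hu, fun i w hw => hb i w (interior_subset hw.1)⟩
  apply analyticOnNhd_of_sepDifferentiableAt hU
  · intro z hz
    obtain ⟨V, hVo, hzV, hVU, u, hu, hb⟩ := hdom' z hz
    refine ContinuousAt.continuousWithinAt ?_
    exact (continuousOn_tsum (fun i => ((hg i).mono hVU).continuousOn) hu hb).continuousAt
      (hVo.mem_nhds hzV)
  · intro z hz j
    obtain ⟨V, hVo, hzV, hVU, u, hu, hb⟩ := hdom' z hz
    have hcont : Continuous (fun w : ℂ => Function.update z j w) :=
      continuous_const.update j continuous_id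
    have hopen : IsOpen ((fun w : ℂ => Function.update z j w) ⁻¹' V) := hVo.preimage hcont
    refine (differentiableOn_tsum_of_summable_norm hu (fun i => ?_) hopen
      (fun i w hw => hb i _ hw)).differentiableAt (hopen.mem_nhds ?_)
    · intro w hw
      refine DifferentiableAt.differentiableWithinAt ?_
      refine DifferentiableAt.comp w ((hg i _ (hVU hw)).differentiableAt) ?_
      exact (hasDerivAt_update z j w).differentiableAt
    · simpa using hzV

end Osgood

/-! ### Tail sums and absolute convergence of the Euler–Zagier series. -/

/-- `(n₁, …, n_r), i ↦ (n₁, …, n_r, n_r + i + 1)`. -/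
def MZIndex.snocEquiv (m : ℕ) : MZIndex (m + 1) × ℕ ≃ MZIndex (m + 2) where
  toFun p := ⟨Fin.snoc (α := fun _ => ℕ) p.1.1 (p.1.1 (Fin.last m) + p.2 + 1), by
    constructor
    · rw [Fin.strictMono_iff_lt_succ]
      intro i
      induction i using Fin.lastCases with
      | last =>
        rw [Fin.succ_last, Fin.snoc_last, Fin.snoc_castSucc]
        omega
      | cast i =>
        rw [Fin.snoc_castSucc, Fin.succ_castSucc, Fin.snoc_castSucc]
        exact p.1.2.1 i.castSucc_lt_succ
    · intro i
      induction i using Fin.lastCases with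
      | last => simp
      | cast i => simpa using p.1.2.2 i⟩
  invFun n := (⟨fun i => n.1 i.castSucc, fun _ _ h => n.2.1 (Fin.castSucc_lt_castSucc_iff.2 h),
      fun i => n.2.2 _⟩,
    n.1 (Fin.last _) - n.1 (Fin.last m).castSucc - 1)
  left_inv p := by
    ext i
    · simp
    · simp only [Fin.snoc_castSucc, Fin.snoc_last]
      omega
  right_inv n := by
    ext i
    induction i using Fin.lastCases with
    | last =>
      simp only [Fin.snoc_last]
      have : n.1 (Fin.last m).castSucc < n.1 (Fin.last _) := n.2.1 (Fin.castSucc_lt_last _)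
      omega
    | cast i => simp

/-- Drop the last variable and add it, together with `c`, to the one before. -/
noncomputable def mergeLast {m : ℕ} (c : ℂ) (s : Fin (m + 2) → ℂ) : Fin (m + 1) → ℂ :=
  fun i => if i = Fin.last m then s i.castSucc + (s (Fin.last _) + c) else s i.castSucc

lemma tailSum_succ (r : ℕ) (s : Fin (r + 1) → ℂ) (k : ℕ) :
    tailSum (r + 1) s (k + 1) = tailSum r (fun i => s i.castSucc) k + s (Fin.last r) := by
  simp only [tailSum, Fin.sum_univ_castSucc, Fin.val_castSucc, Fin.val_last]
  congr 1
  · refine Finset.sum_congr rfl fun i _ => if_congr (by omega) rfl rfl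
  · rw [if_pos (by omega)]

lemma tailSum_zero (r : ℕ) (s : Fin r → ℂ) : tailSum r s 0 = 0 :=
  Finset.sum_eq_zero fun i _ => if_neg (by omega)

/-- Translates conditions on merged tuples back to the original one: tails become one entry longer
and shift by c. -/
lemma tailSum_mergeLast {m : ℕ} (c : ℂ) (s : Fin (m + 2) → ℂ) (k : ℕ) :
    tailSum (m + 1) (mergeLast c s) (k + 1) = tailSum (m + 2) s (k + 2) + c := by
  rw [tailSum_succ, tailSum_succ (m + 1), tailSum_succ m]
  have : (fun i : Fin m => mergeLast c s i.castSucc) = fun i => s i.castSucc.castSucc := by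
    ext i
    simp [mergeLast, (Fin.castSucc_lt_last i).ne]
  rw [this]
  simp only [mergeLast, if_true]
  ring

lemma continuous_tailSum (r k : ℕ) : Continuous fun s => tailSum r s k := by
  unfold tailSum
  refine continuous_finsetSum _ fun i _ => ?_
  split_ifs <;> fun_prop

lemma isOpen_convRegion (r : ℕ) : IsOpen (convRegion r) := by
  have : convRegion r = ⋂ k ∈ Set.Icc 1 r, {s | (k : ℝ) < (tailSum r s k).re} := by
    ext s; simp [convRegion]
  rw [this]
  refine (Set.finite_Icc 1 r).isOpen_biInter fun k _ => ?_
  exact isOpen_lt continuous_const (Complex.continuous_re.comp (continuous_tailSum r k))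

lemma continuous_mergeLast {m : ℕ} (c : ℂ) : Continuous (mergeLast (m := m) c) := by
  refine continuous_pi fun i => ?_
  unfold mergeLast
  split_ifs <;> fun_prop

/-- The bound required of a merged tail is lower by exactly 1, which pays for c = -1, the loss
caused by summing out one index. -/
lemma mergeLast_mem_convRegion {m : ℕ} {s : Fin (m + 2) → ℂ} (hs : s ∈ convRegion (m + 2))
    {c : ℂ} (hc : -1 ≤ c.re) : mergeLast c s ∈ convRegion (m + 1) := by
  intro k hk hk'
  obtain ⟨k, rfl⟩ := Nat.exists_eq_add_of_le' hk
  rw [tailSum_mergeLast]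
  have := hs (k + 2) (by omega) (by omega)
  push_cast at this ⊢
  rw [Complex.add_re]
  linarith

lemma mergeLast_mem_convRegion_of_re_le {m : ℕ} {s : Fin (m + 2) → ℂ} {c d : ℂ}
    (hs : mergeLast c s ∈ convRegion (m + 1)) (hc : c.re ≤ d.re) :
    mergeLast d s ∈ convRegion (m + 1) := by
  intro k hk hk'
  have := hs k hk hk'
  obtain ⟨k, rfl⟩ := Nat.exists_eq_add_of_le' hk
  rw [tailSum_mergeLast] at this ⊢
  rw [Complex.add_re] at this ⊢
  linarith

lemma tailSum_one (r : ℕ) (s : Fin (r + 1) → ℂ) : tailSum (r + 1) s 1 = s (Fin.last r) := by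
  rw [tailSum_succ r s 0, tailSum_zero, zero_add]

lemma one_lt_re_last {r : ℕ} {s : Fin (r + 1) → ℂ} (hs : s ∈ convRegion (r + 1)) :
    1 < (s (Fin.last r)).re := by
  have := hs 1 le_rfl (by omega)
  rwa [tailSum_one, Nat.cast_one] at this

lemma mzTerm_snocEquiv {m : ℕ} (s : Fin (m + 2) → ℂ) (p : MZIndex (m + 1) × ℕ) :
    mzTerm (m + 2) s (MZIndex.snocEquiv m p) = mzTerm (m + 1) (fun i => s i.castSucc) p.1 *
      ((p.1.1 (Fin.last m) : ℂ) + p.2 + 1) ^ (-s (Fin.last _)) := by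
  rw [mzTerm, Fin.prod_univ_castSucc, mzTerm, Complex.cpow_neg]
  simp [MZIndex.snocEquiv]

lemma mzTerm_mergeLast {m : ℕ} (c : ℂ) (s : Fin (m + 2) → ℂ) (n : MZIndex (m + 1)) :
    mzTerm (m + 1) (mergeLast c s) n = mzTerm (m + 1) (fun i => s i.castSucc) n *
      (n.1 (Fin.last m) : ℂ) ^ (-(s (Fin.last _) + c)) := by
  rw [mzTerm, Fin.prod_univ_castSucc, mzTerm, Fin.prod_univ_castSucc, Complex.cpow_neg]
  have h0 : (n.1 (Fin.last m) : ℂ) ≠ 0 := by exact_mod_cast (n.2.2 _).ne'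
  have : ∀ i : Fin m, mergeLast c s i.castSucc = s i.castSucc.castSucc := by
    intro i
    simp [mergeLast, (Fin.castSucc_lt_last i).ne]
  simp only [this]
  simp only [mergeLast, if_true]
  rw [Complex.cpow_add _ _ h0, one_div, one_div, mul_inv, mul_assoc]

lemma norm_mzTerm {r : ℕ} (s : Fin r → ℂ) (n : MZIndex r) :
    ‖mzTerm r s n‖ = ∏ i, (n.1 i : ℝ) ^ (-(s i).re) := by
  rw [mzTerm, norm_prod]
  refine Finset.prod_congr rfl fun i _ => ?_
  rw [norm_div, norm_one, Complex.norm_natCast_cpow_of_pos (n.2.2 i), one_div,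
    Real.rpow_neg (Nat.cast_nonneg _)]

lemma norm_mzTerm_le {r : ℕ} {s t : Fin r → ℂ} (h : ∀ i, (s i).re ≤ (t i).re) (n : MZIndex r) :
    ‖mzTerm r t n‖ ≤ ‖mzTerm r s n‖ := by
  rw [norm_mzTerm, norm_mzTerm]
  refine Finset.prod_le_prod (fun i _ => by positivity) fun i _ => ?_
  refine Real.rpow_le_rpow_of_exponent_le ?_ (neg_le_neg (h i))
  exact_mod_cast n.2.2 i

/-- Comparison with the integral of x^{-τ} from a. -/
lemma sum_range_rpow_neg_le {a τ : ℝ} (ha : 0 < a) (hτ : 1 < τ) (N : ℕ) :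
    ∑ i ∈ Finset.range N, (a + (i + 1 : ℕ)) ^ (-τ) ≤ a ^ (1 - τ) / (τ - 1) := by
  have hanti : AntitoneOn (fun x : ℝ => x ^ (-τ)) (Set.Icc a (a + N)) := by
    intro x hx y hy hxy
    exact Real.rpow_le_rpow_of_nonpos (ha.trans_le hx.1) hxy (by linarith)
  refine hanti.sum_le_integral.trans ?_
  have hN : a ≤ a + N := by simp
  rw [integral_rpow (Or.inr ⟨by linarith, ?_⟩)]
  · have h1 : -τ + 1 = -(τ - 1) := by ring
    have h2 : 1 - τ = -(τ - 1) := by ring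
    rw [h1, h2, div_neg, ← neg_div, neg_sub]
    have := Real.rpow_nonneg (ha.le.trans hN) (-(τ - 1))
    gcongr
    linarith
  · rw [Set.uIcc_of_le hN]
    exact fun h => absurd h.1 (not_le.2 ha)

lemma summable_rpow_neg_shift {a τ : ℝ} (ha : 0 < a) (hτ : 1 < τ) :
    Summable fun i : ℕ => (a + (i + 1 : ℕ)) ^ (-τ) :=
  summable_of_sum_range_le (fun i => by positivity) (sum_range_rpow_neg_le ha hτ)

lemma tsum_rpow_neg_shift_le {a τ : ℝ} (ha : 0 < a) (hτ : 1 < τ) :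
    ∑' i : ℕ, (a + (i + 1 : ℕ)) ^ (-τ) ≤ a ^ (1 - τ) / (τ - 1) :=
  Real.tsum_le_of_sum_range_le (fun i => by positivity) (sum_range_rpow_neg_le ha hτ)

/-- `n ↦ n + 1` onto the index set of the simple zeta series. -/
def MZIndex.oneEquiv : ℕ ≃ MZIndex 1 where
  toFun i := ⟨fun _ => i + 1, Subsingleton.strictMono _, fun _ => Nat.succ_pos _⟩
  invFun n := n.1 0 - 1
  left_inv i := by simp
  right_inv n := by
    ext i
    have := n.2.2 0
    rw [Subsingleton.elim i 0]
    simp only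
    omega

/-- The Euler–Zagier series converges absolutely on `convRegion`. -/
theorem summable_norm_mzTerm {r : ℕ} {s : Fin r → ℂ} (hs : s ∈ convRegion r) :
    Summable fun n => ‖mzTerm r s n‖ := by
  induction r with
  | zero =>
    have : Finite (MZIndex 0) := inferInstance
    exact (hasSum_fintype _).summable
  | succ m ih =>
    cases m with
    | zero =>
      rw [← MZIndex.oneEquiv.summable_iff]
      have := summable_rpow_neg_shift (one_pos) (one_lt_re_last hs)
      rw [← summable_nat_add_iff 1]
      refine this.congr fun i => ?_
      simp only [Function.comp, norm_mzTerm, MZIndex.oneEquiv, Equiv.coe_fn_mk]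
      simp [add_comm]
    | succ m =>
      have hσ := one_lt_re_last hs
      rw [← (MZIndex.snocEquiv m).summable_iff]
      have hpos : ∀ n : MZIndex (m + 1), (0 : ℝ) < n.1 (Fin.last m) := fun n => by
        exact_mod_cast n.2.2 _
      have heq : ((fun n => ‖mzTerm (m + 1 + 1) s n‖) ∘ MZIndex.snocEquiv m) = fun p =>
          ‖mzTerm (m + 1) (fun i => s i.castSucc) p.1‖ *
            ((p.1.1 (Fin.last m) : ℝ) + (p.2 + 1 : ℕ)) ^ (-(s (Fin.last _)).re) := by
        ext p
        rw [Function.comp_apply, mzTerm_snocEquiv, norm_mul]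
        congr 1
        have : ((p.1.1 (Fin.last m) : ℂ) + p.2 + 1) = ((p.1.1 (Fin.last m) + (p.2 + 1) : ℕ) : ℂ) := by
          push_cast; ring
        rw [this, Complex.norm_natCast_cpow_of_pos (by omega)]
        push_cast
        rfl
      rw [heq, summable_prod_of_nonneg (fun p => by
        have := hpos p.1
        simp only [Pi.zero_apply]
        positivity)]
      refine ⟨fun n => ?_, ?_⟩
      · have := (summable_rpow_neg_shift (hpos n) hσ).mul_left
          ‖mzTerm (m + 1) (fun i => s i.castSucc) n‖
        exact this
      -- With σ = Re s_r, summing over the last index costs a factor n_{r-1}^{1-σ}/(σ-1), which is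
      -- the merged series with c = -1.
      have hs' : mergeLast (m := m) (-1) s ∈ convRegion (m + 1) :=
        mergeLast_mem_convRegion hs (by simp)
      have hsum := (ih hs').mul_right ((s (Fin.last (m + 1))).re - 1)⁻¹
      refine Summable.of_nonneg_of_le (fun n => tsum_nonneg fun i => ?_) (fun n => ?_) hsum
      · have := hpos n
        positivity
      · dsimp only
        rw [tsum_mul_left, mzTerm_mergeLast, norm_mul, mul_assoc]
        refine mul_le_mul_of_nonneg_left ?_ (norm_nonneg _)
        refine (tsum_rpow_neg_shift_le (hpos n) hσ).trans (le_of_eq ?_)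
        rw [Complex.norm_natCast_cpow_of_pos (n.2.2 _), div_eq_mul_inv]
        congr 2
        simp [sub_eq_add_neg]

/-- Near a point of `convRegion`, the Euler–Zagier series is dominated by a constant series. -/
theorem exists_mzTerm_dominated {r : ℕ} {s : Fin r → ℂ} (hs : s ∈ convRegion r) :
    ∃ V ∈ 𝓝 s, ∃ u : MZIndex r → ℝ, Summable u ∧ ∀ n, ∀ w ∈ V, ‖mzTerm r w n‖ ≤ u n := by
  -- Lowering all the variables by a small ε/2 stays in the open region, and the absolute series
  -- there dominates on the ε/2-ball around s.
  have hc : Continuous fun ε : ℝ => fun i => s i - (ε : ℂ) := by fun_prop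
  have h0 : (fun i => s i - ((0 : ℝ) : ℂ)) ∈ convRegion r := by simpa using hs
  obtain ⟨ε, hε, hball⟩ := Metric.isOpen_iff.1 ((isOpen_convRegion r).preimage hc) 0 h0
  have hmem : (fun i => s i - ((ε / 2 : ℝ) : ℂ)) ∈ convRegion r := by
    refine hball ?_
    rw [Metric.mem_ball, Real.dist_0_eq_abs, abs_of_pos (by positivity)]
    linarith
  refine ⟨Metric.ball s (ε / 2), Metric.ball_mem_nhds _ (by positivity), _,
    summable_norm_mzTerm hmem, fun n w hw => norm_mzTerm_le (fun i => ?_) n⟩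
  rw [Metric.mem_ball, dist_pi_lt_iff (by positivity)] at hw
  have h1 := (Complex.abs_re_le_norm (w i - s i)).trans_lt (by simpa [dist_eq_norm] using hw i)
  rw [Complex.sub_re] at h1
  rw [Complex.sub_re, Complex.ofReal_re]
  linarith [(abs_lt.1 h1).1]

/-! ### Euler–Maclaurin expansion of the tails of the zeta series. -/

section EulerMaclaurin

open Complex MeasureTheory
open scoped Nat Interval

lemma differentiable_integral_mul_cexp {g : ℝ → ℂ} {l : ℝ → ℝ} (hg : ContinuousOn g (Set.Icc 0 1))
    (hl : ContinuousOn l (Set.Icc 0 1)) :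
    Differentiable ℂ fun s : ℂ => ∫ t in (0 : ℝ)..1, g t * cexp (l t * s) := by
  intro s₀
  obtain ⟨G, hG⟩ := isCompact_Icc.exists_bound_of_continuousOn hg
  obtain ⟨L, hL⟩ := isCompact_Icc.exists_bound_of_continuousOn hl
  have hG0 : 0 ≤ G := (norm_nonneg _).trans (hG 0 (by simp))
  have hL0 : 0 ≤ L := (norm_nonneg _).trans (hL 0 (by simp))
  have hcont : ∀ s : ℂ, ContinuousOn (fun t => g t * cexp (l t * s)) (Set.Icc 0 1) := fun s =>
    hg.mul ((continuous_ofReal.comp_continuousOn hl).mul continuousOn_const).cexp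
  have hcont' : ContinuousOn (fun t => g t * (cexp (l t * s₀) * l t)) (Set.Icc 0 1) :=
    hg.mul ((((continuous_ofReal.comp_continuousOn hl).mul continuousOn_const).cexp).mul
      (continuous_ofReal.comp_continuousOn hl))
  have hI : Ι (0 : ℝ) 1 ⊆ Set.Icc 0 1 := by
    rw [Set.uIoc_of_le zero_le_one]; exact Set.Ioc_subset_Icc_self
  have hmeas : ∀ f : ℝ → ℂ, ContinuousOn f (Set.Icc 0 1) →
      AEStronglyMeasurable f (volume.restrict (Ι (0 : ℝ) 1)) := fun f hf =>
    (hf.mono hI).aestronglyMeasurable measurableSet_uIoc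
  refine (intervalIntegral.hasDerivAt_integral_of_dominated_loc_of_deriv_le
    (F := fun s t => g t * cexp (l t * s)) (F' := fun s t => g t * (cexp (l t * s) * l t))
    (bound := fun _ => G * (Real.exp (L * (‖s₀‖ + 1)) * L))
    (Metric.ball_mem_nhds s₀ one_pos) (Eventually.of_forall fun s => hmeas _ (hcont s)) ?_
    (hmeas _ hcont') ?_ intervalIntegrable_const ?_).2.differentiableAt
  · apply ContinuousOn.intervalIntegrable
    rw [Set.uIcc_of_le zero_le_one]
    exact hcont s₀
  · refine Eventually.of_forall fun t ht s hs => ?_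
    rw [norm_mul, norm_mul, Complex.norm_exp, norm_real]
    have h1 := hL t (hI ht)
    have h2 := hG t (hI ht)
    have hs' : ‖s‖ ≤ ‖s₀‖ + 1 := by
      have := norm_le_norm_add_norm_sub' s s₀
      rw [Metric.mem_ball, dist_eq_norm] at hs
      linarith
    gcongr
    refine (re_le_norm _).trans ?_
    rw [norm_mul, norm_real]
    gcongr
  · refine Eventually.of_forall fun t _ s _ => ?_
    have := (((hasDerivAt_id s).const_mul (l t : ℂ)).cexp).const_mul (g t)
    simpa using this

/-- The coefficient `(s)_k B_{k+1} / (k+1)!` of the Euler–Maclaurin expansion of `∑ n ^ (-s)`. -/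
noncomputable def emCoeff (k : ℕ) (s : ℂ) : ℂ :=
  (ascPochhammer ℂ k).eval s * bernoulli (k + 1) / (k + 1)!

/-- The contribution of `[x, x + 1]` to the Euler–Maclaurin remainder. -/
noncomputable def emStep (N : ℕ) (s : ℂ) (x : ℝ) : ℂ :=
  -((ascPochhammer ℂ N).eval s / N !) *
    ∫ t in (0 : ℝ)..1, (bernoulliFun N t : ℂ) * ((x : ℂ) + t) ^ (-s - N)

/-- The Euler–Maclaurin expansion to order `N` of `∑_{n > x} n ^ (-s)`. -/
noncomputable def emMain (N : ℕ) (s : ℂ) (x : ℂ) : ℂ :=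
  x ^ (1 - s) / (s - 1) + ∑ k ∈ Finset.range N, emCoeff k s * x ^ (-s - k)

lemma add_ofReal_mem_slitPlane {x t : ℝ} (hx : 0 < x) (ht : 0 ≤ t) :
    (x : ℂ) + t ∈ slitPlane := by
  rw [← ofReal_add, ofReal_mem_slitPlane]; linarith

lemma continuousOn_add_cpow {x : ℝ} (hx : 0 < x) (c : ℂ) :
    ContinuousOn (fun t : ℝ => ((x : ℂ) + t) ^ c) (Set.Icc 0 1) :=
  ContinuousOn.cpow_const (by fun_prop) fun _ ht => add_ofReal_mem_slitPlane hx ht.1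

/-- Integration by parts against a Bernoulli polynomial. -/
lemma integral_bernoulliFun_mul_cpow (N : ℕ) {x : ℝ} (hx : 0 < x) (c : ℂ) :
    c * ∫ t in (0 : ℝ)..1, (bernoulliFun (N + 1) t : ℂ) * ((x : ℂ) + t) ^ (c - 1) =
      bernoulliFun (N + 1) 1 * ((x : ℂ) + 1) ^ c - bernoulliFun (N + 1) 0 * (x : ℂ) ^ c -
      (N + 1) * ∫ t in (0 : ℝ)..1, (bernoulliFun N t : ℂ) * ((x : ℂ) + t) ^ c := by
  have hI : Set.uIcc (0 : ℝ) 1 = Set.Icc 0 1 := Set.uIcc_of_le zero_le_one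
  have hB : ∀ k, Continuous fun t : ℝ => (bernoulliFun k t : ℂ) := fun k =>
    continuous_ofReal.comp (continuous_bernoulliFun k)
  have := intervalIntegral.integral_mul_deriv_eq_deriv_mul (a := 0) (b := 1)
    (u := fun t : ℝ => (bernoulliFun (N + 1) t : ℂ))
    (u' := fun t : ℝ => (N + 1 : ℂ) * bernoulliFun N t)
    (v := fun t : ℝ => ((x : ℂ) + t) ^ c) (v' := fun t : ℝ => c * ((x : ℂ) + t) ^ (c - 1))
    (fun t _ => by simpa using (hasDerivAt_bernoulliFun (N + 1) t).ofReal_comp)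
    (fun t ht => by
      rw [hI] at ht
      have h1 : HasDerivAt (fun z : ℂ => (x : ℂ) + z) 1 (t : ℂ) := (hasDerivAt_id _).const_add _
      simpa using (h1.cpow_const (c := c) (add_ofReal_mem_slitPlane hx ht.1)).comp_ofReal)
    ((continuous_const.mul (hB N)).intervalIntegrable _ _)
    (by
      apply ContinuousOn.intervalIntegrable
      rw [hI]
      exact continuousOn_const.mul (continuousOn_add_cpow hx _))
  simp only [ofReal_one, ofReal_zero, add_zero] at this
  rw [← intervalIntegral.integral_const_mul, ← intervalIntegral.integral_const_mul]
  refine (intervalIntegral.integral_congr fun t _ => ?_).trans (this.trans ?_)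
  · ring
  · simp only [mul_assoc]

/-- One integration by parts. For N ≠ 0 the values B_{N+1}(0) and B_{N+1}(1) agree, so the boundary
terms form a difference that telescopes in x. -/
lemma emStep_succ {N : ℕ} (hN : N ≠ 0) (s : ℂ) {x : ℝ} (hx : 0 < x) :
    emStep N s x = emCoeff N s * ((x : ℂ) ^ (-s - N) - ((x : ℂ) + 1) ^ (-s - N)) +
      emStep (N + 1) s x := by
  have h := integral_bernoulliFun_mul_cpow N hx (-s - N)
  rw [bernoulliFun_endpoints_eq_of_ne_one (by omega), bernoulliFun_eval_zero] at h
  have e : -s - ((N + 1 : ℕ) : ℂ) = -s - N - 1 := by push_cast; ring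
  rw [emStep, emStep, e, emCoeff, ascPochhammer_succ_eval, Nat.factorial_succ]
  have h1 : ((N ! : ℕ) : ℂ) ≠ 0 := by exact_mod_cast N.factorial_ne_zero
  have h2 : (N + 1 : ℂ) ≠ 0 := by exact_mod_cast N.succ_ne_zero
  push_cast at h ⊢
  field_simp
  linear_combination (-(Polynomial.eval s (ascPochhammer ℂ N))) * h

/-- Here the endpoint values differ, B_1(1) = 1/2 and B_1(0) = -1/2; this jump is what produces the
summand (x + 1)^{-s}. -/
lemma emStep_one {s : ℂ} (hs : s ≠ 1) {x : ℝ} (hx : 0 < x) :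
    ((x : ℂ) + 1) ^ (-s) = ((x : ℂ) ^ (1 - s) - ((x : ℂ) + 1) ^ (1 - s)) / (s - 1) +
      emCoeff 0 s * ((x : ℂ) ^ (-s) - ((x : ℂ) + 1) ^ (-s)) + emStep 1 s x := by
  have h0 := integral_bernoulliFun_mul_cpow 0 hx (-s)
  have hint : (1 - s) * ∫ t in (0 : ℝ)..1, ((x : ℂ) + t) ^ (-s) =
      ((x : ℂ) + 1) ^ (1 - s) - (x : ℂ) ^ (1 - s) := by
    have hI : Set.uIcc (0 : ℝ) 1 = Set.Icc 0 1 := Set.uIcc_of_le zero_le_one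
    rw [← intervalIntegral.integral_const_mul]
    have := intervalIntegral.integral_eq_sub_of_hasDerivAt (a := 0) (b := 1)
      (f := fun t : ℝ => ((x : ℂ) + t) ^ (1 - s))
      (f' := fun t : ℝ => (1 - s) * ((x : ℂ) + t) ^ (-s))
      (fun t ht => by
        rw [hI] at ht
        have h1 : HasDerivAt (fun z : ℂ => (x : ℂ) + z) 1 (t : ℂ) := (hasDerivAt_id _).const_add _
        simpa using
          (h1.cpow_const (c := 1 - s) (add_ofReal_mem_slitPlane hx ht.1)).comp_ofReal)
      (by
        apply ContinuousOn.intervalIntegrable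
        rw [hI]
        exact continuousOn_const.mul (continuousOn_add_cpow hx _))
    simpa using this
  simp only [zero_add, bernoulliFun_zero, bernoulliFun_one, ofReal_one, one_mul, Nat.cast_zero]
    at h0
  rw [emStep, emCoeff]
  simp only [ascPochhammer_zero, ascPochhammer_one, Polynomial.eval_one, Polynomial.eval_X,
    Nat.factorial, bernoulli_one, zero_add, bernoulliFun_one, Nat.cast_one]
  have hs' : s - 1 ≠ 0 := sub_ne_zero.2 hs
  have hint' : ∫ t in (0 : ℝ)..1, ((x : ℂ) + t) ^ (-s) =
      ((x : ℂ) ^ (1 - s) - ((x : ℂ) + 1) ^ (1 - s)) / (s - 1) := by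
    rw [eq_div_iff hs']
    linear_combination -hint
  rw [hint'] at h0
  push_cast at h0 ⊢
  linear_combination -h0

/-- One step of the Euler–Maclaurin formula. -/
theorem cpow_eq_emMain_sub_add_emStep (N : ℕ) {s : ℂ} (hs : s ≠ 1) {x : ℝ} (hx : 0 < x) :
    ((x : ℂ) + 1) ^ (-s) = emMain (N + 1) s x - emMain (N + 1) s (x + 1) + emStep (N + 1) s x := by
  induction N with
  | zero =>
    rw [emStep_one hs hx]
    simp only [emMain, zero_add, Finset.sum_range_one, Nat.cast_zero, sub_zero]
    ring
  | succ N ih =>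
    rw [ih, emStep_succ N.succ_ne_zero s hx, emMain, emMain, emMain, emMain,
      Finset.sum_range_succ _ (N + 1), Finset.sum_range_succ _ (N + 1)]
    ring

lemma differentiable_emStep (N : ℕ) {x : ℝ} (hx : 0 < x) :
    Differentiable ℂ fun s => emStep N s x := by
  unfold emStep
  refine Differentiable.mul (by
    refine Differentiable.neg (Differentiable.div_const (Polynomial.differentiable _) _)) ?_
  have hl : ContinuousOn (fun t : ℝ => -Real.log (x + t)) (Set.Icc 0 1) := by
    refine ContinuousOn.neg (ContinuousOn.log (by fun_prop) fun t ht => ?_)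
    linarith [ht.1]
  have hg : ContinuousOn (fun t : ℝ => (bernoulliFun N t : ℂ) * ((x : ℂ) + t) ^ (-(N : ℂ)))
      (Set.Icc 0 1) :=
    (continuous_ofReal.comp (continuous_bernoulliFun N)).continuousOn.mul
      (continuousOn_add_cpow hx _)
  convert! differentiable_integral_mul_cexp hg hl using 1
  ext s
  refine intervalIntegral.integral_congr fun t ht => ?_
  rw [Set.uIcc_of_le zero_le_one] at ht
  have hne := slitPlane_ne_zero (add_ofReal_mem_slitPlane hx ht.1)
  rw [mul_assoc]
  congr 1
  rw [sub_eq_neg_add, cpow_add _ _ hne, cpow_def_of_ne_zero hne (-s), ← ofReal_add, ofReal_neg,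
    ofReal_log (by linarith [ht.1])]
  ring_nf

/-- A bound for the Bernoulli polynomial on `[0, 1]`. -/
lemma exists_bernoulliFun_bound (N : ℕ) : ∃ M, 0 ≤ M ∧ ∀ t ∈ Set.Icc (0 : ℝ) 1,
    ‖bernoulliFun N t‖ ≤ M := by
  obtain ⟨M, hM⟩ := isCompact_Icc.exists_bound_of_continuousOn
    (continuous_bernoulliFun N).continuousOn (s := Set.Icc (0 : ℝ) 1)
  exact ⟨M, (norm_nonneg _).trans (hM 0 (by simp)), hM⟩

/-- The constant depends neither on s in the ball nor on x, as domination requires; the exponent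
comes from x + t ≥ x. -/
lemma exists_emStep_bound (N : ℕ) (B : ℝ) : ∃ C, 0 ≤ C ∧ ∀ s : ℂ, ‖s‖ ≤ B → 0 ≤ s.re + N →
    ∀ x : ℝ, 0 < x → ‖emStep N s x‖ ≤ C * x ^ (-(s.re + N)) := by
  obtain ⟨M, hM0, hM⟩ := exists_bernoulliFun_bound N
  obtain ⟨P, hP⟩ := (isCompact_closedBall (0 : ℂ) B).exists_bound_of_continuousOn
    (f := fun s => -((ascPochhammer ℂ N).eval s / (N ! : ℂ)))
    ((Polynomial.continuous _).div_const _).neg.continuousOn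
  refine ⟨|P| * M, by positivity, fun s hs hre x hx => ?_⟩
  have h1 := (hP s (by simpa using hs)).trans (le_abs_self P)
  rw [emStep, norm_mul, mul_assoc]
  refine mul_le_mul h1 ?_ (norm_nonneg _) (abs_nonneg _)
  refine (intervalIntegral.norm_integral_le_of_norm_le_const (C := M * x ^ (-(s.re + N)))
    fun t ht => ?_).trans (by simp)
  rw [Set.uIoc_of_le zero_le_one] at ht
  rw [norm_mul, norm_real, ← ofReal_add, norm_cpow_eq_rpow_re_of_pos (by linarith [ht.1])]
  refine mul_le_mul (hM t ⟨ht.1.le, ht.2⟩) ?_ (by have := ht.1; positivity) hM0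
  have : (-s - (N : ℂ)).re = -(s.re + N) := by simp; ring
  rw [this]
  exact Real.rpow_le_rpow_of_nonpos hx (by linarith [ht.1]) (by linarith)

/-- The Euler–Maclaurin remainder of `∑_{n > a} n ^ (-s)`. -/
noncomputable def emRem (N : ℕ) (s : ℂ) (a : ℕ) : ℂ := ∑' i : ℕ, emStep N s (a + i : ℕ)

lemma tsum_rpow_neg_le {τ : ℝ} {a : ℕ} (ha : 0 < a) (hτ : 1 < τ) :
    (Summable fun i : ℕ => ((a + i : ℕ) : ℝ) ^ (-τ)) ∧
      ∑' i : ℕ, ((a + i : ℕ) : ℝ) ^ (-τ) ≤ (1 + (τ - 1)⁻¹) * (a : ℝ) ^ (1 - τ) := by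
  have ha' : (0 : ℝ) < a := by exact_mod_cast ha
  have ha1 : (1 : ℝ) ≤ a := by exact_mod_cast ha
  have hs := summable_rpow_neg_shift ha' hτ
  have hs' : Summable fun i : ℕ => ((a + i : ℕ) : ℝ) ^ (-τ) := by
    rw [← summable_nat_add_iff 1]
    exact hs.congr fun i => by push_cast; ring_nf
  refine ⟨hs', ?_⟩
  rw [hs'.tsum_eq_zero_add, add_mul, one_mul]
  refine add_le_add ?_ ?_
  · rw [add_zero]
    exact Real.rpow_le_rpow_of_exponent_le ha1 (by linarith)
  · refine le_trans (le_of_eq ?_) ((tsum_rpow_neg_shift_le ha' hτ).trans (le_of_eq ?_))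
    · exact tsum_congr fun i => by push_cast; ring_nf
    · rw [div_eq_mul_inv, mul_comm]

lemma summable_emStep (N : ℕ) {s : ℂ} (hs : 1 < s.re + N) {a : ℕ} (ha : 0 < a) :
    Summable fun i : ℕ => emStep N s (a + i : ℕ) := by
  obtain ⟨C, -, hC⟩ := exists_emStep_bound N ‖s‖
  refine Summable.of_norm_bounded ((tsum_rpow_neg_le ha hs).1.mul_left C) fun i => ?_
  exact hC s le_rfl (by linarith) _ (by exact_mod_cast (by omega : 0 < a + i))

/-- Keeping Re s + N ≥ τ > 1 makes the factor 1/(τ - 1) uniform. The resulting power of a is that of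
a merge with c = N - 1. -/
lemma exists_emRem_bound (N : ℕ) (B : ℝ) {τ : ℝ} (hτ : 1 < τ) : ∃ C, 0 ≤ C ∧ ∀ s : ℂ, ‖s‖ ≤ B →
    τ ≤ s.re + N → ∀ a : ℕ, 0 < a → ‖emRem N s a‖ ≤ C * (a : ℝ) ^ (1 - (s.re + N)) := by
  obtain ⟨C, hC0, hC⟩ := exists_emStep_bound N B
  have hτ' : 0 < τ - 1 := by linarith
  refine ⟨C * (1 + (τ - 1)⁻¹), by positivity, fun s hs hre a ha => ?_⟩
  have hre' : 1 < s.re + N := by linarith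
  obtain ⟨hsum, hle⟩ := tsum_rpow_neg_le ha hre'
  have hb : ∀ i : ℕ, ‖emStep N s (a + i : ℕ)‖ ≤ C * ((a + i : ℕ) : ℝ) ^ (-(s.re + N)) := fun i =>
    hC s hs (by linarith) _ (by exact_mod_cast (by omega : 0 < a + i))
  refine (tsum_of_norm_bounded (hsum.mul_left C).hasSum hb).trans ?_
  rw [tsum_mul_left, mul_assoc]
  refine mul_le_mul_of_nonneg_left (hle.trans ?_) hC0
  gcongr

/-- The Pochhammer factor (-n)_N contains 0. This makes the expansion finite and exact at s = -n. -/
lemma emRem_neg_natCast {N n : ℕ} (h : n < N) (a : ℕ) : emRem N (-n) a = 0 := by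
  have : ∀ x, emStep N (-n) x = 0 := by
    intro x
    rw [emStep, ascPochhammer_eval_neg_coe_nat_of_lt h]
    simp
  simp [emRem, this]

lemma differentiableOn_emRem (N : ℕ) {a : ℕ} (ha : 0 < a) :
    DifferentiableOn ℂ (fun s => emRem N s a) {s | 1 < s.re + N} := by
  intro s₀ hs₀
  apply DifferentiableAt.differentiableWithinAt
  obtain ⟨τ, h1τ, hτ⟩ := exists_between (show 1 < s₀.re + N from hs₀)
  obtain ⟨C, hC0, hC⟩ := exists_emStep_bound N (‖s₀‖ + 1)
  have hopen : IsOpen (Metric.ball s₀ 1 ∩ {s : ℂ | τ < s.re + N}) :=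
    Metric.isOpen_ball.inter (isOpen_lt continuous_const (by fun_prop))
  refine (differentiableOn_tsum_of_summable_norm ((tsum_rpow_neg_le ha h1τ).1.mul_left C)
    (fun i => (differentiable_emStep N ?_).differentiableOn) hopen ?_).differentiableAt
    (hopen.mem_nhds ⟨Metric.mem_ball_self one_pos, hτ⟩)
  · exact_mod_cast (by omega : 0 < a + i)
  · intro i s hs
    have hpos : (0 : ℝ) < (a + i : ℕ) := by exact_mod_cast (by omega : 0 < a + i)
    have hs1 : ‖s‖ ≤ ‖s₀‖ + 1 := by
      have := norm_le_norm_add_norm_sub' s s₀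
      have h2 := hs.1
      rw [Metric.mem_ball, dist_eq_norm] at h2
      linarith
    have hs2 : τ < s.re + N := hs.2
    refine (hC s hs1 (by linarith) _ hpos).trans ?_
    refine mul_le_mul_of_nonneg_left ?_ hC0
    refine Real.rpow_le_rpow_of_exponent_le ?_ (by linarith)
    exact_mod_cast (by omega : 1 ≤ a + i)

lemma tendsto_natCast_add_cpow {c : ℂ} (hc : c.re < 0) (a : ℕ) :
    Tendsto (fun i : ℕ => ((a + i : ℕ) : ℂ) ^ c) atTop (𝓝 0) := by
  rw [tendsto_zero_iff_norm_tendsto_zero]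
  have h1 : Tendsto (fun i : ℕ => ((a + i : ℕ) : ℝ)) atTop atTop :=
    tendsto_natCast_atTop_atTop.comp (tendsto_atTop_mono (fun i => Nat.le_add_left i a) tendsto_id)
  have h2 := (tendsto_rpow_neg_atTop (neg_pos.2 hc)).comp h1
  refine h2.congr' ?_
  filter_upwards [eventually_gt_atTop 0] with i hi
  rw [Function.comp_apply, neg_neg, Complex.norm_natCast_cpow_of_pos (by omega)]

lemma HasSum.sub_succ {f : ℕ → ℂ} (hs : Summable fun i => f i - f (i + 1))
    (hf : Tendsto f atTop (𝓝 0)) : HasSum (fun i => f i - f (i + 1)) (f 0) := by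
  refine (hs.hasSum_iff_tendsto_nat).2 ?_
  simp_rw [Finset.sum_range_sub']
  simpa using tendsto_const_nhds.sub hf

/-- The boundary terms of `emStep_succ` telescope along a, a + 1, …, leaving only the one at a. -/
lemma emRem_succ {N : ℕ} (hN : N ≠ 0) {s : ℂ} (hs : 1 < s.re + N) {a : ℕ} (ha : 0 < a) :
    emRem N s a = emCoeff N s * (a : ℂ) ^ (-s - N) + emRem (N + 1) s a := by
  have h1 := summable_emStep N hs ha
  have h2 := summable_emStep (N + 1) (s := s) (by push_cast; linarith) ha
  have h3 : ∀ i : ℕ, emStep N s (a + i : ℕ) - emStep (N + 1) s (a + i : ℕ) =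
      emCoeff N s * ((a + i : ℕ) : ℂ) ^ (-s - N) -
        emCoeff N s * ((a + (i + 1) : ℕ) : ℂ) ^ (-s - N) := by
    intro i
    rw [emStep_succ hN s (by exact_mod_cast (by omega : 0 < a + i))]
    push_cast
    ring_nf
  have h4 := h1.sub h2
  have h5 : HasSum (fun i : ℕ => emStep N s (a + i : ℕ) - emStep (N + 1) s (a + i : ℕ))
      (emCoeff N s * ((a + 0 : ℕ) : ℂ) ^ (-s - N)) := by
    simp_rw [h3] at h4 ⊢
    refine HasSum.sub_succ h4 ?_
    have := (tendsto_natCast_add_cpow (c := -s - N) (by simp; linarith) a).const_mul (emCoeff N s)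
    simpa using this
  have h6 := h5.unique (h1.hasSum.sub h2.hasSum)
  rw [emRem, emRem]
  rw [add_zero] at h6
  rw [h6]
  ring

/-- The Euler–Maclaurin formula for the tails of the zeta series. -/
theorem hasSum_cpow_neg_shift {N : ℕ} (hN : N ≠ 0) {s : ℂ} (hs : 1 < s.re) {a : ℕ} (ha : 0 < a) :
    HasSum (fun i : ℕ => ((a : ℂ) + i + 1) ^ (-s)) (emMain N s a + emRem N s a) := by
  obtain ⟨N, rfl⟩ := Nat.exists_eq_succ_of_ne_zero hN
  have hs1 : s ≠ 1 := by rintro rfl; simp at hs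
  have h1 := summable_emStep (N + 1) (s := s)
    (by push_cast; have : (0 : ℝ) ≤ N := N.cast_nonneg; linarith) ha
  have h2 : Summable fun i : ℕ => ((a : ℂ) + i + 1) ^ (-s) := by
    refine Summable.of_norm ?_
    have ha' : (0 : ℝ) < a := by exact_mod_cast ha
    refine (summable_rpow_neg_shift ha' hs).congr fun i => ?_
    have : ((a : ℂ) + i + 1) = ((a + (i + 1) : ℕ) : ℂ) := by push_cast; ring
    rw [this, Complex.norm_natCast_cpow_of_pos (by omega)]
    push_cast
    rfl
  have h3 : ∀ i : ℕ, ((a : ℂ) + i + 1) ^ (-s) - emStep (N + 1) s (a + i : ℕ) =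
      emMain (N + 1) s ((a + i : ℕ) : ℂ) - emMain (N + 1) s ((a + (i + 1) : ℕ) : ℂ) := by
    intro i
    have := cpow_eq_emMain_sub_add_emStep N hs1 (x := (a + i : ℕ))
      (by exact_mod_cast (by omega : 0 < a + i))
    push_cast at this ⊢
    rw [this]
    ring_nf
  have h4 := h2.sub h1
  have h5 : HasSum (fun i : ℕ => ((a : ℂ) + i + 1) ^ (-s) - emStep (N + 1) s (a + i : ℕ))
      (emMain (N + 1) s ((a + 0 : ℕ) : ℂ)) := by
    simp_rw [h3] at h4 ⊢
    refine HasSum.sub_succ h4 ?_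
    unfold emMain
    have e1 := (tendsto_natCast_add_cpow (c := 1 - s) (by simp; linarith) a).div_const (s - 1)
    have e2 := tendsto_finsetSum (Finset.range (N + 1)) fun k _ =>
      (tendsto_natCast_add_cpow (c := -s - k)
        (by simp; have : (0 : ℝ) ≤ k := k.cast_nonneg
            linarith) a).const_mul (emCoeff k s)
    simpa using e1.add e2
  have h6 := h5.add h1.hasSum
  simpa [emRem] using h6

end EulerMaclaurin

/-! ### Arithmetic of local quotients of analytic functions. -/

section LocalQuotients

variable {r : ℕ}

/-- Near `z`, `f` is a quotient of holomorphic functions, the denominator not vanishing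
identically. -/
def IsMeromorphicSVAt (f : (Fin r → ℂ) → ℂ) (z : Fin r → ℂ) : Prop :=
  ∃ p q : (Fin r → ℂ) → ℂ,
    AnalyticAt ℂ p z ∧ AnalyticAt ℂ q z ∧ (∃ᶠ w in 𝓝 z, q w ≠ 0) ∧
      ∀ᶠ w in 𝓝 z, q w ≠ 0 → f w = p w / q w

lemma AnalyticAt.isMeromorphicSVAt {f : (Fin r → ℂ) → ℂ} {z : Fin r → ℂ} (hf : AnalyticAt ℂ f z) :
    IsMeromorphicSVAt f z :=
  ⟨f, fun _ => 1, hf, analyticAt_const, Frequently.of_forall (by simp),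
    Eventually.of_forall (by simp)⟩

/-- The product of two germs of analytic functions that do not vanish identically does not vanish
identically. -/
lemma AnalyticAt.frequently_mul_ne_zero {f g : (Fin r → ℂ) → ℂ} {z : Fin r → ℂ}
    (hf : AnalyticAt ℂ f z) (hg : AnalyticAt ℂ g z) (hf0 : ∃ᶠ w in 𝓝 z, f w ≠ 0)
    (hg0 : ∃ᶠ w in 𝓝 z, g w ≠ 0) : ∃ᶠ w in 𝓝 z, f w * g w ≠ 0 := by
  intro h
  simp only [not_not] at h
  obtain ⟨ε, hε, hball⟩ := Metric.eventually_nhds_iff_ball.1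
    (h.and (hf.eventually_analyticAt.and hg.eventually_analyticAt))
  obtain ⟨w, hw0, hw⟩ := (hf0.and_eventually (Metric.ball_mem_nhds z hε)).exists
  have hgw : g =ᶠ[𝓝 w] 0 := by
    filter_upwards [(hball w hw).2.1.continuousAt.eventually_ne hw0,
      Metric.isOpen_ball.mem_nhds hw] with x hx hxb
    exact (mul_eq_zero.1 (hball x hxb).1).resolve_left hx
  have hgball : Set.EqOn g 0 (Metric.ball z ε) :=
    AnalyticOnNhd.eqOn_of_preconnected_of_eventuallyEq (fun x hx => (hball x hx).2.2)
      analyticOnNhd_const (convex_ball z ε).isPreconnected hw hgw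
  obtain ⟨x, hx0, hx⟩ := (hg0.and_eventually (Metric.ball_mem_nhds z hε)).exists
  exact hx0 (hgball hx)

namespace IsMeromorphicSVAt

variable {f g : (Fin r → ℂ) → ℂ} {z : Fin r → ℂ}

lemma congr (hf : IsMeromorphicSVAt f z) (h : f =ᶠ[𝓝 z] g) : IsMeromorphicSVAt g z := by
  obtain ⟨p, q, hp, hq, hq0, hfq⟩ := hf
  refine ⟨p, q, hp, hq, hq0, ?_⟩
  filter_upwards [hfq, h] with w h1 h2 h3
  rw [← h2, h1 h3]

lemma mul (hf : IsMeromorphicSVAt f z) (hg : IsMeromorphicSVAt g z) :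
    IsMeromorphicSVAt (fun w => f w * g w) z := by
  obtain ⟨p, q, hp, hq, hq0, hfq⟩ := hf
  obtain ⟨p', q', hp', hq', hq0', hgq⟩ := hg
  refine ⟨fun w => p w * p' w, fun w => q w * q' w, hp.mul hp', hq.mul hq',
    hq.frequently_mul_ne_zero hq' hq0 hq0', ?_⟩
  filter_upwards [hfq, hgq] with w h1 h2 h3
  rw [h1 (left_ne_zero_of_mul h3), h2 (right_ne_zero_of_mul h3), div_mul_div_comm]

lemma add (hf : IsMeromorphicSVAt f z) (hg : IsMeromorphicSVAt g z) :
    IsMeromorphicSVAt (fun w => f w + g w) z := by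
  obtain ⟨p, q, hp, hq, hq0, hfq⟩ := hf
  obtain ⟨p', q', hp', hq', hq0', hgq⟩ := hg
  refine ⟨fun w => p w * q' w + q w * p' w, fun w => q w * q' w,
    (hp.mul hq').add (hq.mul hp'), hq.mul hq',
    hq.frequently_mul_ne_zero hq' hq0 hq0', ?_⟩
  filter_upwards [hfq, hgq] with w h1 h2 h3
  rw [h1 (left_ne_zero_of_mul h3), h2 (right_ne_zero_of_mul h3),
    div_add_div _ _ (left_ne_zero_of_mul h3) (right_ne_zero_of_mul h3)]

lemma sum {ι : Type*} (s : Finset ι) {F : ι → (Fin r → ℂ) → ℂ}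
    (hF : ∀ i ∈ s, IsMeromorphicSVAt (F i) z) : IsMeromorphicSVAt (fun w => ∑ i ∈ s, F i w) z := by
  classical
  induction s using Finset.induction_on with
  | empty => simpa using (analyticAt_const (v := (0 : ℂ)) (x := z)).isMeromorphicSVAt
  | insert a s ha ih =>
    simp only [Finset.sum_insert ha]
    exact (hF a (Finset.mem_insert_self a s)).add
      (ih fun i hi => hF i (Finset.mem_insert_of_mem hi))

/-- The right inverse σ lifts points near L z where the denominator is nonzero to points near z, so
the pulled-back denominator is not identically zero. -/
lemma comp {r' : ℕ} {L : (Fin r' → ℂ) → (Fin r → ℂ)} {σ : (Fin r → ℂ) → (Fin r' → ℂ)}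
    {z : Fin r' → ℂ} (hf : IsMeromorphicSVAt f (L z)) (hL : AnalyticAt ℂ L z)
    (hσ : Tendsto σ (𝓝 (L z)) (𝓝 z)) (hLσ : ∀ t, L (σ t) = t) :
    IsMeromorphicSVAt (fun w => f (L w)) z := by
  obtain ⟨p, q, hp, hq, hq0, hfq⟩ := hf
  refine ⟨fun w => p (L w), fun w => q (L w), hp.comp hL, hq.comp hL, ?_,
    hL.continuousAt.eventually hfq⟩
  exact hσ.frequently (hq0.mono fun t ht => by simpa only [hLσ] using ht)

end IsMeromorphicSVAt

end LocalQuotients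

/-! ### Depths 0 and 1. -/

section BaseCases

lemma AnalyticAt.comp_eval {r : ℕ} {f : ℂ → ℂ} {z : Fin r → ℂ} (i : Fin r)
    (hf : AnalyticAt ℂ f (z i)) : AnalyticAt ℂ (fun s : Fin r → ℂ => f (s i)) z :=
  hf.comp_of_eq ((ContinuousLinearMap.proj (R := ℂ) (φ := fun _ : Fin r => ℂ) i).analyticAt z) rfl

lemma notMem_singularSet_of_mem_convRegion {r : ℕ} {s : Fin r → ℂ} (hs : s ∈ convRegion r) :
    s ∉ singularSet r := by
  rintro ⟨k, hk, hk', a, ha, hsum⟩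
  have h1 := hs k hk hk'
  rw [hsum, Complex.intCast_re] at h1
  have h2 : (k : ℤ) < a := by exact_mod_cast h1
  rcases ha with ⟨rfl, rfl⟩ | ⟨rfl, rfl | ⟨-, h⟩⟩ | ⟨-, h⟩ <;> omega

theorem isMultipleZeta_zero : IsMultipleZeta 0 fun _ => 1 where
  hasSum s _ := by
    have : Unique (MZIndex 0) :=
      ⟨⟨⟨Fin.elim0, Subsingleton.strictMono _, fun i => i.elim0⟩⟩,
        fun n => Subtype.ext (Subsingleton.elim _ _)⟩
    have h := hasSum_unique (mzTerm 0 s)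
    rwa [show mzTerm 0 s default = 1 by simp [mzTerm]] at h
  analytic := analyticOnNhd_const
  meromorphic _ := analyticAt_const.isMeromorphicSVAt

theorem isMultipleZeta_one : IsMultipleZeta 1 fun s => riemannZeta (s 0) where
  hasSum s hs := by
    have h1 : 1 < (s 0).re := one_lt_re_last hs
    rw [← MZIndex.oneEquiv.hasSum_iff, zeta_eq_tsum_one_div_nat_add_one_cpow h1]
    have h2 : ∀ i : ℕ, (mzTerm 1 s ∘ MZIndex.oneEquiv) i = 1 / ((i : ℂ) + 1) ^ s 0 := by
      intro i
      simp [mzTerm, MZIndex.oneEquiv]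
    have h3 : Summable (mzTerm 1 s ∘ MZIndex.oneEquiv) :=
      MZIndex.oneEquiv.summable_iff.2 (summable_norm_mzTerm hs).of_norm
    rw [← tsum_congr h2]
    exact h3.hasSum
  analytic z hz := by
    have hz0 : z 0 ≠ 1 := by
      intro h
      refine hz ⟨1, le_rfl, le_rfl, 1, Or.inl ⟨rfl, rfl⟩, ?_⟩
      rw [tailSum_one]
      simpa using h
    have h : AnalyticAt ℂ riemannZeta (z 0) := by
      refine DifferentiableOn.analyticAt (s := {1}ᶜ) (fun s hs => ?_)
        (isOpen_compl_singleton.mem_nhds hz0)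
      exact (differentiableAt_riemannZeta hs).differentiableWithinAt
    exact h.comp_eval 0
  meromorphic z := by
    have hproj : ∀ f : ℂ → ℂ, Differentiable ℂ f → AnalyticAt ℂ (fun s : Fin 1 → ℂ => f (s 0)) z :=
      fun f hf => (hf.analyticAt (z 0)).comp_eval 0
    -- `riemannZeta₁` is the entire function extending (s - 1) ζ(s).
    refine ⟨fun s => riemannZeta₁ (s 0), fun s => s 0 - 1, hproj _ differentiable_riemannZeta₁,
      hproj (fun s => s - 1) (by fun_prop), ?_, Eventually.of_forall fun w hw => ?_⟩
    · have h1 : Tendsto (fun c : ℂ => fun _ : Fin 1 => c) (𝓝 (z 0)) (𝓝 z) := by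
        have : Continuous fun c : ℂ => fun _ : Fin 1 => c := by fun_prop
        refine this.tendsto' _ _ (funext fun i => by rw [Subsingleton.elim i 0])
      refine h1.frequently ?_
      have h2 : ∃ᶠ c in 𝓝 (z 0), c ∈ ({1}ᶜ : Set ℂ) :=
        mem_closure_iff_frequently.1 (dense_compl_singleton (1 : ℂ) (z 0))
      exact h2.mono fun c hc => sub_ne_zero.2 hc
    · dsimp only
      rw [riemannZeta_eq_inv_sub_mul (sub_ne_zero.1 hw), div_eq_inv_mul]

end BaseCases

/-! ### Continuation by induction on the depth. -/

section Continuation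

variable {m : ℕ}

/-- The part of the Euler–Zagier series coming from the Euler–Maclaurin remainders of order `N`
in the last variable. -/
noncomputable def mzRem (N : ℕ) (s : Fin (m + 2) → ℂ) : ℂ :=
  ∑' n : MZIndex (m + 1), mzTerm (m + 1) (fun i => s i.castSucc) n *
    emRem N (s (Fin.last _)) (n.1 (Fin.last m))

/-- The order `N` Euler–Maclaurin formula expressing the zeta function of depth `m + 2` through the
one of depth `m + 1`. -/
noncomputable def mzStep (f : (Fin (m + 1) → ℂ) → ℂ) (N : ℕ) (s : Fin (m + 2) → ℂ) : ℂ :=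
  f (mergeLast (-1) s) / (s (Fin.last _) - 1) +
    ∑ k ∈ Finset.range N, emCoeff k (s (Fin.last _)) * f (mergeLast k s) + mzRem N s

/-- The region where `mzRem N` converges absolutely. -/
def mzDomain (m N : ℕ) : Set (Fin (m + 2) → ℂ) :=
  {s | mergeLast ((N : ℂ) - 1) s ∈ convRegion (m + 1) ∧ 1 < (s (Fin.last _)).re + N}

lemma isOpen_mzDomain (m N : ℕ) : IsOpen (mzDomain m N) :=
  ((isOpen_convRegion _).preimage (continuous_mergeLast _)).inter
    (isOpen_lt continuous_const
      (by fun_prop : Continuous fun s : Fin (m + 2) → ℂ => (s (Fin.last _)).re + N))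

lemma mzDomain_mono {N N' : ℕ} (h : N ≤ N') : mzDomain m N ⊆ mzDomain m N' := by
  have h' : (N : ℝ) ≤ N' := by exact_mod_cast h
  exact fun s hs => ⟨mergeLast_mem_convRegion_of_re_le hs.1 (by simpa using h'),
    by linarith [hs.2]⟩

lemma convRegion_subset_mzDomain : convRegion (m + 2) ⊆ mzDomain m 1 := fun s hs =>
  ⟨mergeLast_mem_convRegion hs (by simp), by
    have := one_lt_re_last hs
    simp only [Nat.cast_one]
    linarith⟩

/-- Only finitely many inequalities are involved, and each one is relaxed as N grows. -/
lemma exists_mem_mzDomain (s : Fin (m + 2) → ℂ) : ∃ N, s ∈ mzDomain m N := by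
  obtain ⟨b, hb⟩ := (Set.finite_Icc 0 (m + 1)).image
    (fun k : ℕ => (k : ℝ) + 2 - (tailSum (m + 2) s (k + 1)).re) |>.bddAbove
  obtain ⟨N, hN⟩ := exists_nat_gt b
  have hb' : ∀ k ≤ m + 1, (k : ℝ) + 2 - (tailSum (m + 2) s (k + 1)).re < N := fun k hk =>
    (hb ⟨k, ⟨Nat.zero_le k, hk⟩, rfl⟩).trans_lt hN
  refine ⟨N, fun k hk hk' => ?_, ?_⟩
  · obtain ⟨k, rfl⟩ := Nat.exists_eq_add_of_le' hk
    have := hb' (k + 1) hk'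
    rw [tailSum_mergeLast]
    simp only [Complex.add_re, Complex.sub_re, Complex.natCast_re, Complex.one_re]
    push_cast at this ⊢
    linarith
  · have := hb' 0 (Nat.zero_le _)
    rw [zero_add, tailSum_one] at this
    push_cast at this
    linarith

lemma exists_mzRem_term_bound (N : ℕ) {z : Fin (m + 2) → ℂ} (hz : z ∈ mzDomain m N) :
    ∃ V ∈ 𝓝 z, ∃ u : MZIndex (m + 1) → ℝ, Summable u ∧ ∀ n, ∀ w ∈ V,
      ‖mzTerm (m + 1) (fun i => w i.castSucc) n *
        emRem N (w (Fin.last _)) (n.1 (Fin.last m))‖ ≤ u n := by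
  obtain ⟨V, hV, u, hu, hb⟩ := exists_mzTerm_dominated hz.1
  obtain ⟨τ, h1τ, hτ⟩ := exists_between hz.2
  obtain ⟨C, hC0, hC⟩ := exists_emRem_bound N (‖z‖ + 1) h1τ
  refine ⟨mergeLast ((N : ℂ) - 1) ⁻¹' V ∩ (Metric.ball z 1 ∩ {w | τ < (w (Fin.last _)).re + N}),
    inter_mem ((continuous_mergeLast _).continuousAt hV)
      (inter_mem (Metric.ball_mem_nhds z one_pos)
        ((isOpen_lt continuous_const (by fun_prop)).mem_nhds hτ)), fun n => C * u n,
    hu.mul_left C, fun n w ⟨hw1, hw2, hw3⟩ => ?_⟩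
  have hw : ‖w (Fin.last _)‖ ≤ ‖z‖ + 1 := by
    have h1 := norm_le_norm_add_norm_sub' w z
    rw [Metric.mem_ball, dist_eq_norm] at hw2
    exact (norm_le_pi_norm w _).trans (by linarith)
  -- The remainder bound turns each term into a depth m + 1 term at the tuple merged with c = N - 1,
  -- where a dominating series is known.
  have h1 := hC _ hw hw3.le _ (n.2.2 (Fin.last m))
  have h2 := hb n _ hw1
  rw [mzTerm_mergeLast, norm_mul, Complex.norm_natCast_cpow_of_pos (n.2.2 _)] at h2
  have h3 : (-(w (Fin.last (m + 1)) + ((N : ℂ) - 1))).re =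
      1 - ((w (Fin.last (m + 1))).re + N) := by
    simp; ring
  rw [h3] at h2
  rw [norm_mul]
  calc _ ≤ ‖mzTerm (m + 1) (fun i => w i.castSucc) n‖ *
        (C * (n.1 (Fin.last m) : ℝ) ^ (1 - ((w (Fin.last (m + 1))).re + N))) := by gcongr
    _ ≤ C * u n := by
      rw [mul_left_comm]
      gcongr

lemma summable_mzRem (N : ℕ) {s : Fin (m + 2) → ℂ} (hs : s ∈ mzDomain m N) :
    Summable fun n : MZIndex (m + 1) => mzTerm (m + 1) (fun i => s i.castSucc) n *
      emRem N (s (Fin.last _)) (n.1 (Fin.last m)) := by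
  obtain ⟨V, hV, u, hu, hb⟩ := exists_mzRem_term_bound N hs
  exact Summable.of_norm_bounded hu fun n => hb n s (mem_of_mem_nhds hV)

lemma analyticAt_mzTerm {r : ℕ} (n : MZIndex r) (z : Fin r → ℂ) :
    AnalyticAt ℂ (fun s => mzTerm r s n) z := by
  unfold mzTerm
  refine Finset.analyticAt_fun_prod _ fun i _ => ?_
  have h0 : (n.1 i : ℂ) ≠ 0 := by exact_mod_cast (n.2.2 i).ne'
  have h : Differentiable ℂ fun c : ℂ => 1 / (n.1 i : ℂ) ^ c := by
    refine Differentiable.div (by fun_prop) (fun c => ?_) fun c => ?_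
    · exact ((hasDerivAt_id c).const_cpow (Or.inl h0)).differentiableAt
    · simp [Complex.cpow_eq_zero_iff, h0]
  exact (h.analyticAt (z i)).comp_eval i

lemma analyticOnNhd_mzRem (N : ℕ) : AnalyticOnNhd ℂ (mzRem (m := m) N) (mzDomain m N) := by
  refine analyticOnNhd_tsum (isOpen_mzDomain m N) (fun n z hz => ?_)
    fun z hz => exists_mzRem_term_bound N hz
  refine AnalyticAt.mul ?_ ?_
  · have h : AnalyticAt ℂ (fun s : Fin (m + 2) → ℂ => fun i : Fin (m + 1) => s i.castSucc) z :=
      (ContinuousLinearMap.pi fun i : Fin (m + 1) =>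
        ContinuousLinearMap.proj (R := ℂ) (φ := fun _ : Fin (m + 2) => ℂ) i.castSucc).analyticAt z
    exact (analyticAt_mzTerm n _).comp_of_eq h rfl
  · have hopen : IsOpen {s : ℂ | 1 < s.re + N} := isOpen_lt continuous_const (by fun_prop)
    exact AnalyticAt.comp_eval (Fin.last _) ((differentiableOn_emRem N (n.2.2 _)).analyticAt
      (hopen.mem_nhds hz.2))

lemma analyticAt_mergeLast (c : ℂ) (z : Fin (m + 2) → ℂ) :
    AnalyticAt ℂ (mergeLast (m := m) c) z := by
  rw [analyticAt_pi_iff]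
  intro i
  have hp : ∀ j, AnalyticAt ℂ (fun s : Fin (m + 2) → ℂ => s j) z := fun j =>
    AnalyticAt.comp_eval (f := fun c => c) j analyticAt_id
  unfold mergeLast
  split_ifs
  · exact (hp _).add ((hp _).add analyticAt_const)
  · exact hp _

lemma differentiable_emCoeff (k : ℕ) : Differentiable ℂ (emCoeff k) := by
  unfold emCoeff
  exact ((Polynomial.differentiable _).mul_const _).div_const _

lemma emCoeff_eq_zero {k : ℕ} (hk : k ≠ 0) (he : Even k) (s : ℂ) : emCoeff k s = 0 := by
  rw [emCoeff, bernoulli_eq_zero_of_odd (by simpa [Nat.odd_add_one] using he) (by omega)]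
  simp

/-- Explains the list of hyperplanes: subtracting i ∈ {-1, 0, 1, 3, 5, …} from 1 gives 2, 1, 0, -2,
-4, …; the next merge keeps the values at most 3, and from then on the bound a ≤ k is preserved. -/
lemma IsPolarValue.succ_sub {κ : ℕ} {a i : ℤ} (hκ : 1 ≤ κ) (h : IsPolarValue κ a)
    (hi : -1 ≤ i) (hi' : i = 0 ∨ Odd i) : IsPolarValue (κ + 1) (a - i) := by
  unfold IsPolarValue at *
  rcases h with ⟨rfl, rfl⟩ | ⟨rfl, h⟩ | ⟨h3, h⟩
  · right; left
    refine ⟨rfl, ?_⟩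
    rcases hi' with rfl | ho
    · left; rfl
    · right
      exact ⟨odd_one.sub_odd ho, by linarith⟩
  · right; right
    refine ⟨le_rfl, ?_⟩
    push_cast
    rcases h with rfl | ⟨-, h⟩ <;> linarith
  · right; right
    push_cast
    exact ⟨by omega, by linarith⟩

lemma mergeLast_notMem_singularSet {s : Fin (m + 2) → ℂ} (hs : s ∉ singularSet (m + 2)) {i : ℤ}
    (hi : -1 ≤ i) (hi' : i = 0 ∨ Odd i) : mergeLast (i : ℂ) s ∉ singularSet (m + 1) := by
  rintro ⟨k, hk, hk', a, ha, h⟩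
  refine hs ⟨k + 1, by omega, by omega, a - i, ha.succ_sub hk hi hi', ?_⟩
  obtain ⟨k, rfl⟩ := Nat.exists_eq_add_of_le' hk
  rw [tailSum_mergeLast] at h
  rw [Int.cast_sub, ← h]
  ring

lemma last_ne_one_of_notMem_singularSet {r : ℕ} {s : Fin (r + 1) → ℂ}
    (hs : s ∉ singularSet (r + 1)) : s (Fin.last r) ≠ 1 := by
  intro h
  refine hs ⟨1, le_rfl, by omega, 1, Or.inl ⟨rfl, rfl⟩, ?_⟩
  rw [tailSum_one, h, Int.cast_one]

variable {f : (Fin (m + 1) → ℂ) → ℂ}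

lemma analyticAt_mzStep (hf : IsMultipleZeta (m + 1) f) {N : ℕ} {z : Fin (m + 2) → ℂ}
    (hz : z ∈ mzDomain m N) (hz' : z ∉ singularSet (m + 2)) : AnalyticAt ℂ (mzStep f N) z := by
  have hcomp : ∀ i : ℤ, -1 ≤ i → (i = 0 ∨ Odd i) → AnalyticAt ℂ (fun s => f (mergeLast i s)) z :=
    fun i hi hi' => (hf.analytic _ (mergeLast_notMem_singularSet hz' hi hi')).comp_of_eq
      (analyticAt_mergeLast _ z) rfl
  refine ((AnalyticAt.div ?_ ?_ ?_).add (Finset.analyticAt_fun_sum _ fun k _ => ?_)).add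
    (analyticOnNhd_mzRem N z hz)
  · simpa using hcomp (-1) le_rfl (Or.inr ⟨-1, by norm_num⟩)
  · exact AnalyticAt.comp_eval (f := fun c => c - 1) _ (by fun_prop)
  · exact sub_ne_zero.2 (last_ne_one_of_notMem_singularSet hz')
  -- For even k ≥ 2 the merged tuple may be singular, but the coefficient is identically zero.
  · by_cases hk : k ≠ 0 ∧ Even k
    · simpa only [emCoeff_eq_zero hk.1 hk.2, zero_mul] using analyticAt_const
    · refine AnalyticAt.mul (((differentiable_emCoeff k).analyticAt _).comp_eval _) ?_
      have := hcomp k (by omega) (by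
        rw [not_and_or, not_not, Nat.not_even_iff_odd] at hk
        exact hk.imp (fun h => by exact_mod_cast h) fun h => by exact_mod_cast h)
      simpa using this

lemma isMeromorphicSVAt_mzStep (hf : IsMultipleZeta (m + 1) f) {N : ℕ} {z : Fin (m + 2) → ℂ}
    (hz : z ∈ mzDomain m N) : IsMeromorphicSVAt (mzStep f N) z := by
  have hcomp : ∀ c : ℂ, IsMeromorphicSVAt (fun s => f (mergeLast c s)) z := by
    intro c
    -- A section of the merging map: freeze the last variable at its value in z and undo the
    -- addition.
    refine IsMeromorphicSVAt.comp (σ := fun t => Fin.snoc (α := fun _ => ℂ)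
      (fun i => if i = Fin.last m then t i - (z (Fin.last _) + c) else t i) (z (Fin.last _)))
      (hf.meromorphic _) (analyticAt_mergeLast c z) ?_ ?_
    · refine Continuous.tendsto' (Continuous.finSnoc ?_ continuous_const) _ _ ?_
      · refine continuous_pi fun i => ?_
        split_ifs <;> fun_prop
      · ext i
        induction i using Fin.lastCases with
        | last => simp
        | cast i => by_cases h : i = Fin.last m <;> simp [h, mergeLast]
    · intro t
      ext i
      by_cases h : i = Fin.last m <;> simp [h, mergeLast]
  refine ((IsMeromorphicSVAt.add ?_ (IsMeromorphicSVAt.sum _ fun k _ => ?_)).add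
    (analyticOnNhd_mzRem N z hz).isMeromorphicSVAt)
  · simp only [div_eq_mul_inv]
    refine (hcomp (-1)).mul ⟨fun _ => 1, fun s => s (Fin.last _) - 1, analyticAt_const,
      AnalyticAt.comp_eval (f := fun c => c - 1) _ (by fun_prop), ?_,
      Eventually.of_forall fun w _ => (one_div _).symm⟩
    have h1 : Tendsto (fun c : ℂ => Function.update z (Fin.last _) c) (𝓝 (z (Fin.last _)))
        (𝓝 z) := by
      have : Continuous fun c : ℂ => Function.update z (Fin.last _) c :=
        continuous_const.update _ continuous_id
      exact this.tendsto' _ _ (Function.update_eq_self _ _)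
    refine h1.frequently ?_
    have h2 : ∃ᶠ c in 𝓝 (z (Fin.last _)), c ∈ ({1}ᶜ : Set ℂ) :=
      mem_closure_iff_frequently.1 (dense_compl_singleton (1 : ℂ) _)
    exact h2.mono fun c hc => by simpa using sub_ne_zero.2 hc
  · exact (((differentiable_emCoeff k).analyticAt _).comp_eval _).isMeromorphicSVAt.mul (hcomp k)

/-- Where the order N remainder converges, the next Euler–Maclaurin term is itself a convergent
series and can be split off from it. Hence the order is irrelevant and the local formulas glue. -/
lemma mzStep_succ (hf : IsMultipleZeta (m + 1) f) {N : ℕ} (hN : N ≠ 0) {s : Fin (m + 2) → ℂ}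
    (hs : s ∈ mzDomain m N) : mzStep f (N + 1) s = mzStep f N s := by
  have h1 : HasSum (mzTerm (m + 1) (mergeLast N s)) (f (mergeLast N s)) :=
    hf.hasSum _ (mergeLast_mem_convRegion_of_re_le hs.1 (by simp))
  have h2 := (h1.mul_left (emCoeff N (s (Fin.last _)))).add
    (summable_mzRem (N + 1) (mzDomain_mono N.le_succ hs)).hasSum
  have h3 : mzRem N s = emCoeff N (s (Fin.last _)) * f (mergeLast N s) + mzRem (N + 1) s := by
    rw [mzRem, mzRem, ← h2.tsum_eq]
    refine tsum_congr fun n => ?_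
    rw [emRem_succ hN hs.2 (n.2.2 _), mzTerm_mergeLast, neg_add, ← sub_eq_add_neg]
    ring
  rw [mzStep, mzStep, h3, Finset.sum_range_succ]
  ring

lemma mzStep_eq_of_le (hf : IsMultipleZeta (m + 1) f) {N N' : ℕ} (hN : N ≠ 0) (h : N ≤ N')
    {s : Fin (m + 2) → ℂ} (hs : s ∈ mzDomain m N) : mzStep f N' s = mzStep f N s := by
  induction N', h using Nat.le_induction with
  | base => rfl
  | succ k hk ih => rw [mzStep_succ hf (by omega) (mzDomain_mono hk hs), ih]

lemma hasSum_mzStep (hf : IsMultipleZeta (m + 1) f) {s : Fin (m + 2) → ℂ}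
    (hs : s ∈ convRegion (m + 2)) : HasSum (mzTerm (m + 2) s) (mzStep f 1 s) := by
  have h1 : Summable (mzTerm (m + 2) s ∘ MZIndex.snocEquiv m) :=
    (MZIndex.snocEquiv m).summable_iff.2 (summable_norm_mzTerm hs).of_norm
  have h2 : ∀ n : MZIndex (m + 1),
      HasSum (fun i => (mzTerm (m + 2) s ∘ MZIndex.snocEquiv m) (n, i))
        (mzTerm (m + 1) (fun i => s i.castSucc) n *
          (emMain 1 (s (Fin.last _)) (n.1 (Fin.last m)) +
            emRem 1 (s (Fin.last _)) (n.1 (Fin.last m)))) := by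
    intro n
    simp only [Function.comp, mzTerm_snocEquiv]
    exact (hasSum_cpow_neg_shift one_ne_zero (one_lt_re_last hs) (n.2.2 _)).mul_left _
  -- Two evaluations of one sum: innermost index first, against term by term in the expansion.
  have h3 := h1.hasSum.prod_fiberwise h2
  have hconv : ∀ c : ℂ, -1 ≤ c.re →
      HasSum (mzTerm (m + 1) (mergeLast c s)) (f (mergeLast c s)) := fun c hc =>
    hf.hasSum _ (mergeLast_mem_convRegion hs hc)
  have h4 := (((hconv (-1) (by simp)).div_const (s (Fin.last _) - 1)).add
    (hasSum_sum (s := Finset.range 1) fun k _ => (hconv k (by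
      have : (0 : ℝ) ≤ k := k.cast_nonneg
      simp; linarith)).mul_left (emCoeff k (s (Fin.last _))))).add
    (summable_mzRem 1 (convRegion_subset_mzDomain hs)).hasSum
  rw [← (MZIndex.snocEquiv m).hasSum_iff]
  convert! h1.hasSum using 1
  refine HasSum.unique ?_ h3
  convert! h4 using 1
  ext n
  simp only [mzTerm_mergeLast, emMain, Finset.sum_range_one]
  have e : 1 - s (Fin.last (m + 1)) = -(s (Fin.last (m + 1)) + -1) := by ring
  rw [e]
  simp only [Nat.cast_zero, add_zero, sub_zero]
  ring

open Classical in
/-- The continuation of the Euler–Zagier series of depth `m + 2`. -/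
noncomputable def mzGlue (f : (Fin (m + 1) → ℂ) → ℂ) (s : Fin (m + 2) → ℂ) : ℂ :=
  -- The `+ 1` keeps the order nonzero, as independence of the order requires.
  mzStep f (Nat.find (exists_mem_mzDomain s) + 1) s

lemma mzGlue_eq (hf : IsMultipleZeta (m + 1) f) {N : ℕ} (hN : N ≠ 0) {s : Fin (m + 2) → ℂ}
    (hs : s ∈ mzDomain m N) : mzGlue f s = mzStep f N s := by
  classical
  have h1 := Nat.find_spec (exists_mem_mzDomain s)
  rw [mzGlue]
  set M := Nat.find (exists_mem_mzDomain s)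
  have h2 := mzDomain_mono M.le_succ h1
  rcases le_total (M + 1) N with h | h
  · rw [mzStep_eq_of_le hf M.succ_ne_zero h h2]
  · rw [mzStep_eq_of_le hf hN h hs]

lemma mzGlue_eventuallyEq (hf : IsMultipleZeta (m + 1) f) (z : Fin (m + 2) → ℂ) :
    ∃ N, z ∈ mzDomain m N ∧ mzStep f N =ᶠ[𝓝 z] mzGlue f := by
  obtain ⟨N, hN⟩ := exists_mem_mzDomain z
  have hN' := mzDomain_mono N.le_succ hN
  refine ⟨N + 1, hN', ?_⟩
  filter_upwards [(isOpen_mzDomain m (N + 1)).mem_nhds hN'] with w hw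
  exact (mzGlue_eq hf N.succ_ne_zero hw).symm

theorem isMultipleZeta_mzGlue (hf : IsMultipleZeta (m + 1) f) :
    IsMultipleZeta (m + 2) (mzGlue f) where
  hasSum s hs := by
    rw [mzGlue_eq hf one_ne_zero (convRegion_subset_mzDomain hs)]
    exact hasSum_mzStep hf hs
  analytic z hz := by
    obtain ⟨N, hN, h⟩ := mzGlue_eventuallyEq hf z
    exact (analyticAt_mzStep hf hN hz).congr h
  meromorphic z := by
    obtain ⟨N, hN, h⟩ := mzGlue_eventuallyEq hf z
    exact (isMeromorphicSVAt_mzStep hf hN).congr h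

theorem exists_isMultipleZeta : ∀ r : ℕ, ∃ f, IsMultipleZeta r f
  | 0 => ⟨_, isMultipleZeta_zero⟩
  | 1 => ⟨_, isMultipleZeta_one⟩
  | m + 2 => by
    obtain ⟨f, hf⟩ := exists_isMultipleZeta (m + 1)
    exact ⟨_, isMultipleZeta_mzGlue hf⟩

theorem isMultipleZeta_multipleZeta (r : ℕ) : IsMultipleZeta r (multipleZeta r) :=
  Classical.epsilon_spec (exists_isMultipleZeta r)

end Continuation

/-! ### Uniqueness off the singular set, along complex lines. -/

section Uniqueness

lemma tailSum_add_smul (r : ℕ) (s d : Fin r → ℂ) (z : ℂ) (k : ℕ) :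
    tailSum r (s + z • d) k = tailSum r s k + z * tailSum r d k := by
  rw [tailSum, tailSum, tailSum, Finset.mul_sum, ← Finset.sum_add_distrib]
  refine Finset.sum_congr rfl fun i _ => ?_
  split_ifs <;> simp

/-- A complex line through a regular point meets the singular set in countably many points. -/
lemma countable_singularSet_line {r : ℕ} {s : Fin r → ℂ} (hs : s ∉ singularSet r)
    (d : Fin r → ℂ) : {z : ℂ | s + z • d ∈ singularSet r}.Countable := by
  have hsub : {z : ℂ | s + z • d ∈ singularSet r} ⊆ ⋃ k : ℕ, ⋃ a : ℤ,
      {z : ℂ | tailSum r s k ≠ a ∧ tailSum r s k + z * tailSum r d k = a} := by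
    rintro z ⟨k, hk, hk', a, ha, h⟩
    rw [tailSum_add_smul] at h
    simp only [Set.mem_iUnion]
    exact ⟨k, a, fun h' => hs ⟨k, hk, hk', a, ha, h'⟩, h⟩
  refine Set.Countable.mono hsub (Set.countable_iUnion fun k => Set.countable_iUnion fun a => ?_)
  -- For fixed k and a the condition is affine in z and fails at z = 0, so it has at most one
  -- solution.
  refine Set.Subsingleton.countable fun z ⟨hz, hz'⟩ w ⟨_, hw'⟩ => ?_
  have hd : tailSum r d k ≠ 0 := by
    intro h
    rw [h, mul_zero, add_zero] at hz'
    exact hz hz'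
  exact mul_right_cancel₀ hd (by linear_combination hz' - hw')

/-- The identity theorem on the complement of a countable set. -/
lemma eq_of_eventuallyEq_of_countable {S : Set ℂ} (hS : S.Countable) {F G : ℂ → ℂ}
    (hF : ∀ z ∉ S, AnalyticAt ℂ F z) (hG : ∀ z ∉ S, AnalyticAt ℂ G z) {z₀ z₁ : ℂ} (h₀ : z₀ ∉ S)
    (h₁ : z₁ ∉ S) (h : F =ᶠ[𝓝 z₁] G) : F z₀ = G z₀ := by
  have hc : IsPreconnected Sᶜ :=
    (hS.isConnected_compl_of_one_lt_rank (by simp [Complex.rank_real_complex])).isPreconnected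
  exact AnalyticOnNhd.eqOn_of_preconnected_of_eventuallyEq (U := Sᶜ) hF hG hc h₁ h h₀

lemma analyticAt_add_smul {r : ℕ} (s d : Fin r → ℂ) (z : ℂ) :
    AnalyticAt ℂ (fun z : ℂ => s + z • d) z :=
  analyticAt_const.add (analyticAt_id.smul analyticAt_const)

lemma eventually_add_smul_mem {r : ℕ} {W : Set (Fin r → ℂ)} (hW : IsOpen W) {s₁ : Fin r → ℂ}
    (h : s₁ ∈ W) (s : Fin r → ℂ) : ∀ᶠ z in 𝓝 (1 : ℂ), s + z • (s₁ - s) ∈ W := by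
  refine (analyticAt_add_smul s (s₁ - s) 1).continuousAt (hW.mem_nhds ?_)
  simpa using h

lemma exists_lt_tailSum_re (r : ℕ) (B : ℝ) :
    ∃ s : Fin r → ℂ, ∀ k, 1 ≤ k → k ≤ r → B < (tailSum r s k).re := by
  cases r with
  | zero => exact ⟨0, fun k hk hk' => by omega⟩
  | succ r =>
    -- Every nonempty tail contains the last variable, so all tail sums equal B + 1.
    refine ⟨Pi.single (Fin.last r) ((B + 1 : ℝ) : ℂ), fun k hk _ => ?_⟩
    obtain ⟨k, rfl⟩ := Nat.exists_eq_add_of_le' hk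
    have h : (fun i : Fin r => (Pi.single (Fin.last r) ((B + 1 : ℝ) : ℂ) : Fin (r + 1) → ℂ)
        i.castSucc) = 0 := by
      ext i
      simp [(Fin.castSucc_lt_last i).ne]
    rw [tailSum_succ, h]
    simp [tailSum]

/-- The continuation of the Euler–Zagier series is unique off the singular set. -/
theorem IsMultipleZeta.eq {r : ℕ} {f g : (Fin r → ℂ) → ℂ} (hf : IsMultipleZeta r f)
    (hg : IsMultipleZeta r g) {s : Fin r → ℂ} (hs : s ∉ singularSet r) : f s = g s := by
  obtain ⟨s₁, hs₁⟩ := exists_lt_tailSum_re r r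
  have hconv : s₁ ∈ convRegion r := fun k hk hk' =>
    lt_of_le_of_lt (by exact_mod_cast hk') (hs₁ k hk hk')
  have h1 : s + (1 : ℂ) • (s₁ - s) = s₁ := by simp
  -- The line runs from s at z = 0 to s₁ at z = 1, near which both functions are the sum of the
  -- series.
  have := eq_of_eventuallyEq_of_countable (countable_singularSet_line hs (s₁ - s))
    (F := fun z => f (s + z • (s₁ - s))) (G := fun z => g (s + z • (s₁ - s))) (z₀ := 0) (z₁ := 1)
    (fun z hz => (hf.analytic _ hz).comp_of_eq (analyticAt_add_smul _ _ z) rfl)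
    (fun z hz => (hg.analytic _ hz).comp_of_eq (analyticAt_add_smul _ _ z) rfl)
    (by simpa using hs) (by
      rw [Set.mem_ofPred_eq, h1]; exact notMem_singularSet_of_mem_convRegion hconv) (by
      filter_upwards [eventually_add_smul_mem (isOpen_convRegion r) hconv s] with z hz
      exact (hf.hasSum _ hz).unique (hg.hasSum _ hz))
  simpa using this

end Uniqueness

/-! ### Shifting one variable and inserting a value. -/

section Shift

variable {m : ℕ}

/-- Add `c` to the variable in position `p`. -/
noncomputable def shiftAt (p : Fin m) (c : ℂ) (t : Fin m → ℂ) : Fin m → ℂ :=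
  fun l => if l = p then t l + c else t l

lemma tailSum_shiftAt (p : Fin m) (c : ℂ) (t : Fin m → ℂ) (k : ℕ) :
    tailSum m (shiftAt p c t) k = tailSum m t k + if m ≤ (p : ℕ) + k then c else 0 := by
  have : ∀ i : Fin m, (if m ≤ (i : ℕ) + k then shiftAt p c t i else 0) =
      (if m ≤ (i : ℕ) + k then t i else 0) +
        if i = p then (if m ≤ (p : ℕ) + k then c else 0) else 0 := by
    intro i
    unfold shiftAt
    by_cases h : i = p
    · subst h
      split_ifs <;> simp
    · simp [h]
  rw [tailSum, Finset.sum_congr rfl fun i _ => this i, Finset.sum_add_distrib,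
    Finset.sum_ite_eq' Finset.univ p, if_pos (Finset.mem_univ p)]
  rfl

lemma mzTerm_shiftAt (p : Fin m) (c : ℂ) (t : Fin m → ℂ) (N : MZIndex m) :
    mzTerm m (shiftAt p c t) N = mzTerm m t N * (N.1 p : ℂ) ^ (-c) := by
  have : ∀ i : Fin m, 1 / (N.1 i : ℂ) ^ shiftAt p c t i =
      1 / (N.1 i : ℂ) ^ t i * if i = p then (N.1 p : ℂ) ^ (-c) else 1 := by
    intro i
    have h0 : (N.1 i : ℂ) ≠ 0 := by exact_mod_cast (N.2.2 i).ne'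
    unfold shiftAt
    by_cases h : i = p
    · subst h
      rw [if_pos rfl, if_pos rfl, Complex.cpow_add _ _ h0, Complex.cpow_neg, one_div, one_div,
        mul_inv]
    · rw [if_neg h, if_neg h, mul_one]
  rw [mzTerm, Finset.prod_congr rfl fun i _ => this i, Finset.prod_mul_distrib,
    Finset.prod_ite_eq' Finset.univ p, if_pos (Finset.mem_univ p)]
  rfl

lemma analyticAt_shiftAt (p : Fin m) (c : ℂ) (z : Fin m → ℂ) : AnalyticAt ℂ (shiftAt p c) z := by
  rw [analyticAt_pi_iff]
  intro i
  have hp : ∀ j, AnalyticAt ℂ (fun s : Fin m → ℂ => s j) z := fun j =>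
    AnalyticAt.comp_eval (f := fun c => c) j analyticAt_id
  unfold shiftAt
  split_ifs
  · exact (hp _).add analyticAt_const
  · exact hp _

lemma shiftBefore_eq (j : Fin (m + 1)) (hj : j ≠ 0) (c : ℂ) (t : Fin m → ℂ) :
    shiftBefore j c t = shiftAt (j.pred hj) c t := by
  have := Fin.val_ne_zero_iff.2 hj
  ext l
  refine if_congr ?_ rfl rfl
  rw [Fin.ext_iff, Fin.val_pred]
  omega

lemma shiftAfter_eq (j : Fin (m + 1)) (hj : j ≠ Fin.last m) (c : ℂ) (t : Fin m → ℂ) :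
    shiftAfter j c t = shiftAt (j.castPred hj) c t := by
  ext l
  refine if_congr ?_ rfl rfl
  rw [Fin.ext_iff, Fin.coe_castPred]

lemma tailSum_insertNth_of_le (j : Fin (m + 1)) (x : ℂ) (t : Fin m → ℂ) {k : ℕ}
    (h : m ≤ (j : ℕ) + k) :
    tailSum (m + 1) (j.insertNth (α := fun _ => ℂ) x t) (k + 1) = x + tailSum m t k := by
  rw [tailSum, Fin.sum_univ_succAbove _ j, if_pos (by omega), Fin.insertNth_apply_same]
  congr 1
  refine Finset.sum_congr rfl fun i _ => ?_
  rw [Fin.insertNth_apply_succAbove]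
  refine if_congr ?_ rfl rfl
  simp only [Fin.succAbove, Fin.lt_def]
  split_ifs with h' <;> simp at * <;> omega

lemma tailSum_insertNth_of_lt (j : Fin (m + 1)) (x : ℂ) (t : Fin m → ℂ) {k : ℕ}
    (h : (j : ℕ) + k ≤ m) :
    tailSum (m + 1) (j.insertNth (α := fun _ => ℂ) x t) k = tailSum m t k := by
  rw [tailSum, Fin.sum_univ_succAbove _ j, if_neg (by omega), zero_add]
  refine Finset.sum_congr rfl fun i _ => ?_
  rw [Fin.insertNth_apply_succAbove]
  refine if_congr ?_ rfl rfl
  simp only [Fin.succAbove, Fin.lt_def]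
  split_ifs with h' <;> simp at * <;> omega

/-- Merging an inserted value `x` into a neighbouring position leads from regular points to
regular points. -/
lemma shiftAt_notMem_singularSet {j : Fin (m + 1)} {p : Fin m}
    (hp : (p : ℕ) = j ∨ (p : ℕ) + 1 = j) {x : ℂ} {t : Fin m → ℂ}
    (ht : j.insertNth (α := fun _ => ℂ) x t ∉ singularSet (m + 1)) {i : ℤ}
    (hi : -1 ≤ i) (hi' : i = 0 ∨ Odd i) : shiftAt p (x + i) t ∉ singularSet m := by
  rintro ⟨k, hk, hk', a, ha, h⟩
  rw [tailSum_shiftAt] at h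
  -- Tails containing p correspond to tails of the full tuple with the inserted entry added; shorter
  -- tails are unaffected.
  split_ifs at h with hpk
  · refine ht ⟨k + 1, by omega, by omega, a - i, ha.succ_sub hk hi hi', ?_⟩
    rw [tailSum_insertNth_of_le _ _ _ (by omega)]
    push_cast
    linear_combination h
  · refine ht ⟨k, hk, by omega, a, ha, ?_⟩
    rw [tailSum_insertNth_of_lt _ _ _ (by omega)]
    linear_combination h

lemma notMem_singularSet_of_insertNth_zero {x : ℂ} {t : Fin m → ℂ}
    (ht : (0 : Fin (m + 1)).insertNth (α := fun _ => ℂ) x t ∉ singularSet (m + 1)) :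
    t ∉ singularSet m := by
  rintro ⟨k, hk, hk', a, ha, h⟩
  refine ht ⟨k, hk, by omega, a, ha, ?_⟩
  rw [tailSum_insertNth_of_lt _ _ _ (by simpa using hk'), h]

end Shift

/-! ### Faulhaber's formula in terms of zeta values. -/

section PowerSums

/-- The sign (-1)^k in ζ(-k) = (-1)^k B_{k+1}/(k+1) matters only at k = 0, since B_{k+1} = 0 for
even k ≥ 2; hence the correction there. -/
lemma bernoulli_succ_div (k : ℕ) :
    (bernoulli (k + 1) : ℂ) / (k + 1) = -riemannZeta (-(k : ℂ)) - if k = 0 then 1 else 0 := by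
  rw [riemannZeta_neg_nat_eq_bernoulli]
  rcases eq_or_ne k 0 with rfl | hk
  · norm_num [bernoulli_one]
  · rw [if_neg hk, sub_zero]
    rcases Nat.even_or_odd k with he | ho
    · rw [bernoulli_eq_zero_of_odd (by simpa [Nat.odd_add_one] using he) (by omega)]
      simp
    · rw [ho.neg_one_pow]
      ring

/-- A polynomial in `b` whose differences are the powers `b ^ n`. -/
noncomputable def powerSumPoly (n : ℕ) (b : ℂ) : ℂ :=
  1 / ((n : ℂ) + 1) * b ^ (n + 1) -
    ∑ k ∈ Finset.range (n + 1), (n.choose k : ℂ) * b ^ (n - k) * riemannZeta (-(k : ℂ))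

/-- Faulhaber's formula stops at B_n, so the k = n term of `powerSumPoly` must be added back as
ζ(-n). The b^n is the correction at k = 0, absent for n = 0. -/
lemma sum_range_pow_eq_powerSumPoly (n b : ℕ) : ∑ x ∈ Finset.range b, (x : ℂ) ^ n =
    powerSumPoly n b + riemannZeta (-(n : ℂ)) - if n = 0 then 0 else (b : ℂ) ^ n := by
  have h := congrArg (fun q : ℚ => (q : ℂ)) (sum_range_pow b n)
  push_cast at h
  rw [h, Finset.sum_range_succ', powerSumPoly, Finset.sum_range_succ]
  have hn : (n : ℂ) + 1 ≠ 0 := by exact_mod_cast n.succ_ne_zero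
  have hterm : ∀ k ∈ Finset.range n, (bernoulli (k + 1) : ℂ) * ((n + 1).choose (k + 1) : ℂ) *
      (b : ℂ) ^ (n + 1 - (k + 1)) / (n + 1) =
      -((n.choose k : ℂ) * (b : ℂ) ^ (n - k) * riemannZeta (-(k : ℂ))) -
        if k = 0 then (b : ℂ) ^ n else 0 := by
    intro k _
    have hk : (k : ℂ) + 1 ≠ 0 := by exact_mod_cast k.succ_ne_zero
    have h1 : ((n : ℂ) + 1) * n.choose k = (n + 1).choose (k + 1) * (k + 1) := by
      exact_mod_cast Nat.add_one_mul_choose_eq n k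
    have h2 : (bernoulli (k + 1) : ℂ) * ((n + 1).choose (k + 1) : ℂ) *
        (b : ℂ) ^ (n + 1 - (k + 1)) / (n + 1) =
        n.choose k * (b : ℂ) ^ (n - k) * ((bernoulli (k + 1) : ℂ) / (k + 1)) := by
      rw [Nat.add_sub_add_right]
      field_simp
      linear_combination -(bernoulli (k + 1) : ℂ) * (b : ℂ) ^ (n - k) * h1
    rw [h2, bernoulli_succ_div]
    rcases eq_or_ne k 0 with rfl | hk
    · simp; ring
    · simp [hk]
  rw [Finset.sum_congr rfl hterm, Finset.sum_sub_distrib, Finset.sum_neg_distrib]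
  rcases n with _ | n
  · simp
  · rw [Finset.sum_ite_eq', if_pos (Finset.mem_range.2 n.succ_pos), if_neg n.succ_ne_zero]
    simp
    ring

/-- Sums of `n`-th powers between `0` and `b`. -/
lemma sum_Ioo_zero_pow (n : ℕ) {b : ℕ} (hb : 0 < b) : ∑ x ∈ Finset.Ioo 0 b, (x : ℂ) ^ n =
    powerSumPoly n b + riemannZeta (-(n : ℂ)) - (b : ℂ) ^ n := by
  have h := sum_range_pow_eq_powerSumPoly n b
  have h1 : Finset.range b = insert 0 (Finset.Ioo 0 b) := by
    ext x
    simp only [Finset.mem_range, Finset.mem_insert, Finset.mem_Ioo]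
    omega
  rw [h1, Finset.sum_insert (by simp)] at h
  rcases eq_or_ne n 0 with rfl | hn
  · simp only [if_true, pow_zero] at h ⊢
    linear_combination h
  · simp only [if_neg hn, Nat.cast_zero, zero_pow hn, zero_add] at h
    exact h

/-- Sums of `n`-th powers strictly between `a` and `b`. -/
lemma sum_Ioo_pow (n : ℕ) {a b : ℕ} (ha : 0 < a) (hab : a < b) :
    ∑ x ∈ Finset.Ioo a b, (x : ℂ) ^ n = powerSumPoly n b - powerSumPoly n a - (b : ℂ) ^ n := by
  have h1 : Finset.Ioo 0 b = Finset.Ioo 0 a ∪ insert a (Finset.Ioo a b) := by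
    ext x
    simp only [Finset.mem_union, Finset.mem_insert, Finset.mem_Ioo]
    omega
  have h2 : Disjoint (Finset.Ioo 0 a) (insert a (Finset.Ioo a b)) := by
    rw [Finset.disjoint_left]
    intro x
    simp only [Finset.mem_insert, Finset.mem_Ioo]
    omega
  -- The constant ζ(-n) cancels on subtraction, so it survives in the theorem only for j = 1.
  have h := sum_Ioo_zero_pow n (ha.trans hab)
  rw [h1, Finset.sum_union h2, Finset.sum_insert (by simp), sum_Ioo_zero_pow n ha] at h
  linear_combination h

lemma ascPochhammer_eval_neg_natCast (n k : ℕ) :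
    (ascPochhammer ℂ k).eval (-(n : ℂ)) = (-1) ^ k * n.descFactorial k := by
  induction k with
  | zero => simp
  | succ k ih =>
    rw [ascPochhammer_succ_eval, ih, Nat.descFactorial_succ]
    rcases le_or_gt k n with h | h
    · push_cast [h]
      ring
    · rw [Nat.descFactorial_of_lt h]
      simp

/-- The sign of (-n)_k = (-1)^k n!/(n-k)! (for k ≤ n) is the one in ζ(-k) = (-1)^k B_{k+1}/(k+1). -/
lemma emCoeff_neg_natCast (n k : ℕ) :
    emCoeff k (-(n : ℂ)) = n.choose k * riemannZeta (-(k : ℂ)) := by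
  rw [emCoeff, ascPochhammer_eval_neg_natCast, riemannZeta_neg_nat_eq_bernoulli,
    Nat.descFactorial_eq_factorial_mul_choose, Nat.factorial_succ]
  have h1 : (k.factorial : ℂ) ≠ 0 := by exact_mod_cast k.factorial_ne_zero
  have h2 : (k : ℂ) + 1 ≠ 0 := by exact_mod_cast k.succ_ne_zero
  push_cast
  field_simp

end PowerSums

/-! ### Splitting off one summation index. -/

section InsertIndex

variable {m : ℕ}

/-- The entry before the position `j`, read as `0` if there is none. -/
def MZIndex.before (j : Fin (m + 1)) (n : MZIndex m) : ℕ :=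
  if h : j = 0 then 0 else n.1 (j.pred h)

lemma MZIndex.strictMono_insertNth {j : Fin (m + 1)} (hj : j ≠ Fin.last m) (n : MZIndex m) {x : ℕ}
    (h₁ : n.before j < x) (h₂ : x < n.1 (j.castPred hj)) :
    StrictMono (j.insertNth (α := fun _ => ℕ) x n.1) := by
  intro a b hab
  rcases Fin.eq_self_or_eq_succAbove j a with rfl | ⟨a, rfl⟩
  · rcases Fin.eq_self_or_eq_succAbove a b with rfl | ⟨b, rfl⟩
    · exact absurd hab (lt_irrefl _)
    · rw [Fin.insertNth_apply_same, Fin.insertNth_apply_succAbove]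
      refine h₂.trans_le (n.2.1.monotone ?_)
      rw [Fin.lt_succAbove_iff_le_castSucc] at hab
      simpa [Fin.le_def] using hab
  · rcases Fin.eq_self_or_eq_succAbove j b with rfl | ⟨b, rfl⟩
    · rw [Fin.insertNth_apply_same, Fin.insertNth_apply_succAbove]
      refine lt_of_le_of_lt ?_ h₁
      rw [Fin.succAbove_lt_iff_castSucc_lt] at hab
      have hb : b ≠ 0 := (Fin.zero_le _).trans_lt hab |>.ne'
      rw [MZIndex.before, dif_neg hb]
      refine n.2.1.monotone ?_
      rw [Fin.le_def, Fin.val_pred]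
      rw [Fin.lt_def, Fin.val_castSucc] at hab
      omega
    · rw [Fin.insertNth_apply_succAbove, Fin.insertNth_apply_succAbove]
      exact n.2.1 ((Fin.strictMono_succAbove j).lt_iff_lt.1 hab)

/-- Splitting off the entry in a position `j` which is not the last one. -/
def MZIndex.insertEquiv (j : Fin (m + 1)) (hj : j ≠ Fin.last m) :
    (Σ n : MZIndex m, {x : ℕ // x ∈ Finset.Ioo (n.before j) (n.1 (j.castPred hj))}) ≃
      MZIndex (m + 1) where
  toFun p := ⟨j.insertNth (α := fun _ => ℕ) p.2.1 p.1.1,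
    p.1.strictMono_insertNth hj (Finset.mem_Ioo.1 p.2.2).1 (Finset.mem_Ioo.1 p.2.2).2, by
      rw [Fin.forall_iff_succAbove j]
      refine ⟨?_, fun i => ?_⟩
      · rw [Fin.insertNth_apply_same]
        exact (Nat.zero_le _).trans_lt (Finset.mem_Ioo.1 p.2.2).1
      · rw [Fin.insertNth_apply_succAbove]
        exact p.1.2.2 i⟩
  invFun n := ⟨⟨fun i => n.1 (j.succAbove i), n.2.1.comp (Fin.strictMono_succAbove j),
      fun i => n.2.2 _⟩, n.1 j, by
    rw [Finset.mem_Ioo]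
    constructor
    · unfold MZIndex.before
      split_ifs with h
      · exact n.2.2 j
      · refine n.2.1 ?_
        rw [Fin.succAbove_lt_iff_castSucc_lt, Fin.lt_def, Fin.val_castSucc, Fin.val_pred]
        have := Fin.val_ne_zero_iff.2 h
        omega
    · refine n.2.1 ?_
      rw [Fin.lt_succAbove_iff_le_castSucc, Fin.castSucc_castPred]⟩
  left_inv p := by
    refine Sigma.subtype_ext ?_ ?_
    · exact Subtype.ext (funext fun i => by simp)
    · simp
  right_inv n := by
    refine Subtype.ext (funext fun i => ?_)
    rcases Fin.eq_self_or_eq_succAbove j i with rfl | ⟨i, rfl⟩ <;> simp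

lemma mzTerm_insertEquiv (j : Fin (m + 1)) (hj : j ≠ Fin.last m) (n : ℕ) (t : Fin m → ℂ)
    (p : Σ n : MZIndex m, {x : ℕ // x ∈ Finset.Ioo (n.before j) (n.1 (j.castPred hj))}) :
    mzTerm (m + 1) (j.insertNth (α := fun _ => ℂ) (-(n : ℂ)) t) (MZIndex.insertEquiv j hj p) =
      mzTerm m t p.1 * (p.2.1 : ℂ) ^ n := by
  rw [mzTerm, Fin.prod_univ_succAbove _ j, mul_comm, mzTerm]
  simp [MZIndex.insertEquiv, Complex.cpow_neg]

end InsertIndex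

/-! ### The series obtained from the power sums. -/

section ShiftedSums

variable {m : ℕ}

/-- The combination of zeta values produced by summing `n`-th powers up to the entry in
position `p`. -/
noncomputable def powerSumZeta (n : ℕ) (p : Fin m) (t : Fin m → ℂ) : ℂ :=
  1 / ((n : ℂ) + 1) * multipleZeta m (shiftAt p (-(n : ℂ) - 1) t) -
    ∑ k ∈ Finset.range (n + 1), (n.choose k : ℂ) *
      multipleZeta m (shiftAt p (-(n : ℂ) + (k : ℂ)) t) * riemannZeta (-(k : ℂ))

/-- A region where all series of the reduction formula of order `n` converge. -/
def deepConvRegion (m n : ℕ) : Set (Fin m → ℂ) :=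
  {t | ∀ k : ℕ, 1 ≤ k → k ≤ m → (k : ℝ) + n + 1 < (tailSum m t k).re}

lemma isOpen_deepConvRegion (m n : ℕ) : IsOpen (deepConvRegion m n) := by
  have : deepConvRegion m n =
      ⋂ k ∈ Set.Icc 1 m, {t | (k : ℝ) + n + 1 < (tailSum m t k).re} := by
    ext t; simp [deepConvRegion]
  rw [this]
  refine (Set.finite_Icc 1 m).isOpen_biInter fun k _ => ?_
  exact isOpen_lt continuous_const (Complex.continuous_re.comp (continuous_tailSum m k))

lemma deepConvRegion_nonempty (m n : ℕ) : (deepConvRegion m n).Nonempty := by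
  obtain ⟨t, ht⟩ := exists_lt_tailSum_re m (m + n + 1)
  refine ⟨t, fun k hk hk' => lt_of_le_of_lt ?_ (ht k hk hk')⟩
  have : (k : ℝ) ≤ m := by exact_mod_cast hk'
  linarith

variable {n : ℕ} {t : Fin m → ℂ}

lemma deepConvRegion_subset : deepConvRegion m n ⊆ convRegion m := fun t ht k hk hk' => by
  have h1 := ht k hk hk'
  have h2 : (0 : ℝ) ≤ n := n.cast_nonneg
  linarith

lemma shiftAt_mem_convRegion (ht : t ∈ deepConvRegion m n) (p : Fin m) {c : ℂ}
    (hc : -(n + 1 : ℝ) ≤ c.re) : shiftAt p c t ∈ convRegion m := by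
  intro k hk hk'
  have h1 := ht k hk hk'
  have h2 : (0 : ℝ) ≤ n := n.cast_nonneg
  rw [tailSum_shiftAt]
  split_ifs
  · rw [Complex.add_re]; linarith
  · rw [add_zero]; linarith

/-- A tail through position j is one entry longer and loses n, exactly the margin n + 1. At the last
position the tail would be -n alone, which never converges. -/
lemma insertNth_mem_convRegion (ht : t ∈ deepConvRegion m n) {j : Fin (m + 1)}
    (hj : j ≠ Fin.last m) :
    j.insertNth (α := fun _ => ℂ) (-(n : ℂ)) t ∈ convRegion (m + 1) := by
  intro k hk hk'
  have hj' : (j : ℕ) < m := Fin.val_lt_last hj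
  have h2 : (0 : ℝ) ≤ n := n.cast_nonneg
  rcases le_or_gt ((j : ℕ) + k) m with h | h
  · rw [tailSum_insertNth_of_lt _ _ _ h]
    have := ht k hk (by omega)
    linarith
  · obtain ⟨k, rfl⟩ := Nat.exists_eq_add_of_le' hk
    rw [tailSum_insertNth_of_le _ _ _ (by omega)]
    have := ht k (by omega) (by omega)
    simp only [Complex.add_re, Complex.neg_re, Complex.natCast_re]
    push_cast
    linarith

lemma hasSum_mzTerm_mul_pow (ht : t ∈ deepConvRegion m n) (p : Fin m) {k : ℕ} (hk : k ≤ n + 1)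
    {c : ℂ} (hc : c = -(k : ℂ)) :
    HasSum (fun N : MZIndex m => mzTerm m t N * (N.1 p : ℂ) ^ k)
      (multipleZeta m (shiftAt p c t)) := by
  have hk' : (k : ℝ) ≤ n + 1 := by exact_mod_cast hk
  have := (isMultipleZeta_multipleZeta m).hasSum _ (shiftAt_mem_convRegion ht p (c := c) (by
    rw [hc]; simpa using hk'))
  refine this.congr_fun fun N => ?_
  rw [mzTerm_shiftAt, hc, neg_neg, Complex.cpow_natCast]

lemma hasSum_powerSumZeta (ht : t ∈ deepConvRegion m n) (p : Fin m) :
    HasSum (fun N : MZIndex m => mzTerm m t N * powerSumPoly n (N.1 p)) (powerSumZeta n p t) := by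
  have h1 := (hasSum_mzTerm_mul_pow ht p le_rfl (c := -(n : ℂ) - 1)
    (by push_cast; ring)).mul_left (1 / ((n : ℂ) + 1))
  have h2 := hasSum_sum (s := Finset.range (n + 1)) fun k hk =>
    ((hasSum_mzTerm_mul_pow ht p (k := n - k) (c := -(n : ℂ) + k) (by omega) (by
      rw [Nat.cast_sub (by rw [Finset.mem_range] at hk; omega)]; ring)).mul_left
        (n.choose k : ℂ)).mul_right (riemannZeta (-(k : ℂ)))
  refine (h1.sub h2).congr_fun ?_
  intro N
  rw [powerSumPoly, mul_sub, Finset.mul_sum]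
  congr 1
  · ring
  · exact Finset.sum_congr rfl fun k _ => by ring

lemma analyticAt_powerSumZeta {j : Fin (m + 1)} {p : Fin m}
    (hp : (p : ℕ) = j ∨ (p : ℕ) + 1 = j)
    (ht : j.insertNth (α := fun _ => ℂ) (-(n : ℂ)) t ∉ singularSet (m + 1)) :
    AnalyticAt ℂ (powerSumZeta n p) t := by
  have hcomp : ∀ i : ℤ, -1 ≤ i → (i = 0 ∨ Odd i) →
      AnalyticAt ℂ (fun t => multipleZeta m (shiftAt p (-(n : ℂ) + i) t)) t := fun i hi hi' =>
    ((isMultipleZeta_multipleZeta m).analytic _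
      (shiftAt_notMem_singularSet hp ht hi hi')).comp_of_eq (analyticAt_shiftAt _ _ t) rfl
  refine (analyticAt_const.mul ?_).sub (Finset.analyticAt_fun_sum _ fun k _ => ?_)
  · simpa [sub_eq_add_neg] using hcomp (-1) le_rfl (Or.inr ⟨-1, by norm_num⟩)
  -- The shifted tuple may be singular for even k ≥ 2, but then ζ(-k) = 0.
  · by_cases hk : k ≠ 0 ∧ Even k
    · have : riemannZeta (-(k : ℂ)) = 0 := by
        rw [riemannZeta_neg_nat_eq_bernoulli,
          bernoulli_eq_zero_of_odd (by simpa [Nat.odd_add_one] using hk.2) (by omega)]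
        simp
      simpa only [this, mul_zero] using analyticAt_const
    · refine (analyticAt_const.mul ?_).mul analyticAt_const
      have := hcomp k (by omega) (by
        rw [not_and_or, not_not, Nat.not_even_iff_odd] at hk
        exact hk.imp (fun h => by exact_mod_cast h) fun h => by exact_mod_cast h)
      simpa using this

end ShiftedSums

/-! ### The reduction formula, away from the last position and at it. -/

section Reduction

variable {m : ℕ}

/-- The reduction formula at a position which is not the last one, as an identity of series. -/
lemma multipleZeta_insertNth_of_mem {j : Fin (m + 1)} (hj : j ≠ Fin.last m) {n : ℕ}
    {t : Fin m → ℂ} (ht : t ∈ deepConvRegion m n) :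
    multipleZeta (m + 1) (j.insertNth (α := fun _ => ℂ) (-(n : ℂ)) t) =
      powerSumZeta n (j.castPred hj) t - multipleZeta m (shiftAt (j.castPred hj) (-(n : ℂ)) t) +
        if h : j = 0 then riemannZeta (-(n : ℂ)) * multipleZeta m t
        else -powerSumZeta n (j.pred h) t := by
  have h1 := (isMultipleZeta_multipleZeta (m + 1)).hasSum _ (insertNth_mem_convRegion ht hj)
  rw [← (MZIndex.insertEquiv j hj).hasSum_iff] at h1
  -- The index in position j is summed first, over a finite interval.
  have h2 := h1.sigma fun N => hasSum_fintype _
  refine h2.unique ?_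
  have h3 := (hasSum_powerSumZeta ht (j.castPred hj)).sub
    (hasSum_mzTerm_mul_pow ht (j.castPred hj) (k := n) (by omega) rfl)
  have h4 : ∀ N : MZIndex m, ∑ x : {x : ℕ // x ∈ Finset.Ioo (N.before j) (N.1 (j.castPred hj))},
      (mzTerm (m + 1) (j.insertNth (α := fun _ => ℂ) (-(n : ℂ)) t) ∘ MZIndex.insertEquiv j hj)
        ⟨N, x⟩ = mzTerm m t N *
          ∑ x ∈ Finset.Ioo (N.before j) (N.1 (j.castPred hj)), (x : ℂ) ^ n := by
    intro N
    simp only [Function.comp, mzTerm_insertEquiv]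
    rw [← Finset.mul_sum, Finset.sum_coe_sort _ fun x : ℕ => (x : ℂ) ^ n]
  by_cases h0 : j = 0
  · rw [dif_pos h0]
    refine (h3.add (((isMultipleZeta_multipleZeta m).hasSum _
      (deepConvRegion_subset ht)).mul_left (riemannZeta (-(n : ℂ))))).congr_fun fun N => ?_
    rw [h4, MZIndex.before, dif_pos h0, sum_Ioo_zero_pow n (N.2.2 _)]
    ring
  · rw [dif_neg h0]
    refine (h3.add (hasSum_powerSumZeta ht (j.pred h0)).neg).congr_fun fun N => ?_
    rw [h4, MZIndex.before, dif_neg h0, sum_Ioo_pow n (N.2.2 _) (N.2.1 ?_)]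
    · ring
    · have := Fin.val_ne_zero_iff.2 h0
      rw [Fin.lt_def, Fin.val_pred, Fin.coe_castPred]
      omega

lemma insertNth_add_smul (j : Fin (m + 1)) (x : ℂ) (t d : Fin m → ℂ) (z : ℂ) :
    j.insertNth (α := fun _ => ℂ) x (t + z • d) =
      j.insertNth (α := fun _ => ℂ) x t + z • j.insertNth (α := fun _ => ℂ) 0 d := by
  ext i
  rcases Fin.eq_self_or_eq_succAbove j i with rfl | ⟨i, rfl⟩ <;> simp

/-- The reduction formula at a position which is not the last one. -/
theorem multipleZeta_insertNth {j : Fin (m + 1)} (hj : j ≠ Fin.last m) {n : ℕ}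
    {t : Fin m → ℂ} (ht : j.insertNth (α := fun _ => ℂ) (-(n : ℂ)) t ∉ singularSet (m + 1)) :
    multipleZeta (m + 1) (j.insertNth (α := fun _ => ℂ) (-(n : ℂ)) t) =
      powerSumZeta n (j.castPred hj) t - multipleZeta m (shiftAt (j.castPred hj) (-(n : ℂ)) t) +
        if h : j = 0 then riemannZeta (-(n : ℂ)) * multipleZeta m t
        else -powerSumZeta n (j.pred h) t := by
  obtain ⟨t₁, ht₁⟩ := deepConvRegion_nonempty m n
  -- The line has direction 0 in position j, so it stays in the hyperplane s_j = -n.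
  set S : Set ℂ := {z | j.insertNth (α := fun _ => ℂ) (-(n : ℂ)) (t + z • (t₁ - t)) ∈
    singularSet (m + 1)} with hS
  have hScount : S.Countable := by
    simp only [hS, insertNth_add_smul]
    exact countable_singularSet_line ht _
  have hp : ((j.castPred hj : Fin m) : ℕ) = j ∨ ((j.castPred hj : Fin m) : ℕ) + 1 = j :=
    Or.inl (Fin.coe_castPred _ _)
  have key := eq_of_eventuallyEq_of_countable hScount
    (F := fun z => multipleZeta (m + 1)
      (j.insertNth (α := fun _ => ℂ) (-(n : ℂ)) (t + z • (t₁ - t))))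
    (G := fun z => powerSumZeta n (j.castPred hj) (t + z • (t₁ - t)) -
      multipleZeta m (shiftAt (j.castPred hj) (-(n : ℂ)) (t + z • (t₁ - t))) +
        if h : j = 0 then riemannZeta (-(n : ℂ)) * multipleZeta m (t + z • (t₁ - t))
        else -powerSumZeta n (j.pred h) (t + z • (t₁ - t))) (z₀ := 0) (z₁ := 1)
    (fun z hz => ?_) (fun z hz => ?_) (by simpa [hS] using ht) ?_ ?_
  · simpa using key
  · simp only [insertNth_add_smul]
    refine ((isMultipleZeta_multipleZeta (m + 1)).analytic _ ?_).comp_of_eq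
      (analyticAt_add_smul _ _ z) rfl
    rw [← insertNth_add_smul]
    exact hz
  · have hline := analyticAt_add_smul t (t₁ - t) z
    refine (((analyticAt_powerSumZeta hp hz).comp_of_eq hline rfl).sub ?_).add ?_
    · have h1 := shiftAt_notMem_singularSet hp hz (i := 0) (by norm_num) (Or.inl rfl)
      rw [Int.cast_zero, add_zero] at h1
      exact (((isMultipleZeta_multipleZeta m).analytic _ h1).comp_of_eq
        (analyticAt_shiftAt _ _ _) rfl).comp_of_eq hline rfl
    · by_cases h0 : j = 0
      · simp only [dif_pos h0]
        subst h0
        exact analyticAt_const.mul (((isMultipleZeta_multipleZeta m).analytic _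
          (notMem_singularSet_of_insertNth_zero hz)).comp_of_eq hline rfl)
      · simp only [dif_neg h0]
        have hp' : ((j.pred h0 : Fin m) : ℕ) = j ∨ ((j.pred h0 : Fin m) : ℕ) + 1 = j := by
          have := Fin.val_ne_zero_iff.2 h0
          right
          rw [Fin.val_pred]
          omega
        exact ((analyticAt_powerSumZeta hp' hz).comp_of_eq hline rfl).neg
  · intro h
    refine notMem_singularSet_of_mem_convRegion (insertNth_mem_convRegion ht₁ hj) ?_
    simpa [hS] using h
  · filter_upwards [eventually_add_smul_mem (isOpen_deepConvRegion m n) ht₁ t] with z hz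
    exact multipleZeta_insertNth_of_mem hj hz

lemma mergeLast_insertNth_last (c x : ℂ) (t : Fin (m + 1) → ℂ) :
    mergeLast c ((Fin.last (m + 1)).insertNth (α := fun _ => ℂ) x t) =
      shiftAt (Fin.last m) (x + c) t := by
  ext i
  simp [mergeLast, shiftAt, Fin.insertNth_last']

lemma mzRem_insertNth_last {n N : ℕ} (h : n < N) (t : Fin (m + 1) → ℂ) :
    mzRem N ((Fin.last (m + 1)).insertNth (α := fun _ => ℂ) (-(n : ℂ)) t) = 0 := by
  rw [mzRem]
  simp only [Fin.insertNth_apply_same, emRem_neg_natCast h, mul_zero, tsum_zero]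

/-- The reduction formula at the last position. -/
theorem multipleZeta_insertNth_last {n : ℕ} {t : Fin (m + 1) → ℂ}
    (ht : (Fin.last (m + 1)).insertNth (α := fun _ => ℂ) (-(n : ℂ)) t ∉ singularSet (m + 2)) :
    multipleZeta (m + 2) ((Fin.last (m + 1)).insertNth (α := fun _ => ℂ) (-(n : ℂ)) t) =
      -powerSumZeta n (Fin.last m) t := by
  have hf := isMultipleZeta_multipleZeta (m + 1)
  obtain ⟨M, hM⟩ := exists_mem_mzDomain
    ((Fin.last (m + 1)).insertNth (α := fun _ => ℂ) (-(n : ℂ)) t)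
  -- An order that is both large enough for the domain and larger than n, so the remainder vanishes.
  have hM' := mzDomain_mono (show M ≤ n + 1 + M by omega) hM
  rw [(isMultipleZeta_multipleZeta (m + 2)).eq (isMultipleZeta_mzGlue hf) ht,
    mzGlue_eq hf (by omega) hM', mzStep, mzRem_insertNth_last (by omega)]
  simp only [mergeLast_insertNth_last, Fin.insertNth_apply_same, emCoeff_neg_natCast]
  rw [Finset.sum_subset (Finset.range_subset_range.2 (show n + 1 ≤ n + 1 + M by omega))
    (fun k _ hk => by
      rw [Finset.mem_range, not_lt] at hk
      rw [Nat.choose_eq_zero_of_lt hk]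
      simp) |>.symm]
  have hdiv : ∀ x : ℂ, x / (-(n : ℂ) - 1) = -(1 / ((n : ℂ) + 1) * x) := fun x => by
    rw [← neg_add', div_neg, one_div, div_eq_inv_mul]
  rw [powerSumZeta, add_zero, ← sub_eq_add_neg, hdiv, neg_sub, neg_add_eq_sub]
  congr 1
  exact Finset.sum_congr rfl fun k _ => by ring

end Reduction

theorem theorem2p10 :
    (∀ r : ℕ, IsMultipleZeta r (multipleZeta r)) ∧
    ∀ (m : ℕ), 1 ≤ m → ∀ (j : Fin (m + 1)) (n : ℕ) (t : Fin m → ℂ),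
      j.insertNth (α := fun _ => ℂ) (-(n : ℂ)) t ∉ singularSet (m + 1) →
      multipleZeta (m + 1) (j.insertNth (α := fun _ => ℂ) (-(n : ℂ)) t) =
        - (1 - kdelta j 0) * (1 / ((n : ℂ) + 1)) *
            multipleZeta m (shiftBefore j (-(n : ℂ) - 1) t)
        + (1 - kdelta j (Fin.last m)) * (1 / ((n : ℂ) + 1)) *
            multipleZeta m (shiftAfter j (-(n : ℂ) - 1) t)
        + (1 - kdelta j 0) *
            ∑ k ∈ Finset.range (n + 1), (n.choose k : ℂ) *
              multipleZeta m (shiftBefore j (-(n : ℂ) + (k : ℂ)) t) * riemannZeta (-(k : ℂ))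
        - (1 - kdelta j (Fin.last m)) *
            ∑ k ∈ Finset.range (n + 1), (n.choose k : ℂ) *
              multipleZeta m (shiftAfter j (-(n : ℂ) + (k : ℂ)) t) * riemannZeta (-(k : ℂ))
        + kdelta j 0 * (1 - kdelta j (Fin.last m)) *
            (riemannZeta (-(n : ℂ)) * multipleZeta m t)
        + (kdelta j (Fin.last m) - 1) * multipleZeta m (shiftAfter j (-(n : ℂ)) t) := by
  refine ⟨isMultipleZeta_multipleZeta, fun m hm j n t ht => ?_⟩
  obtain ⟨m, rfl⟩ := Nat.exists_eq_add_of_le' hm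
  by_cases hj : j = Fin.last (m + 1)
  · subst hj
    have h0 : Fin.last (m + 1) ≠ 0 := Fin.last_pos.ne'
    have hpred : (Fin.last (m + 1)).pred h0 = Fin.last m := by simp [Fin.ext_iff]
    rw [multipleZeta_insertNth_last ht, powerSumZeta]
    simp only [kdelta, if_neg h0, if_true, shiftBefore_eq _ h0, hpred]
    ring
  · rw [multipleZeta_insertNth hj ht]
    simp only [powerSumZeta, kdelta, if_neg hj, shiftAfter_eq _ hj]
    by_cases h0 : j = 0
    · rw [dif_pos h0, if_pos h0]
      ring
    · simp only [dif_neg h0, if_neg h0, shiftBefore_eq _ h0]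
      ring
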